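/- An affine semigroup is a finitely generated submonoid $S$ of $\mathbb N^m\subseteq\mathbb Z^m$; let $A$ be its minimal generating system, $\mathrm G(S)\subseteq\mathbb Z^m$ the group it spans, and $$\mathrm{relint}(\mathrm{cone}(S))=\Big\{\sum_{a\in A}q_a a \;\Big|\; q_a\in\mathbb Q_{>0}\Big\}.$$ A Frobenius vector of $S$ is a vector $f\in \mathrm G(S)\setminus S$ such that $f+(\mathrm{relint}(\mathrm{cone}(S))\cap \mathrm G(S))\subseteq S$. A minimal presentation of $S$ is an inclusion-minimal generating set of the kernel congruence of the homomorphism $\mathbb N^{A}\to S$, $(n_a)_a\mapsto\sum_a n_a a$; $S$ is a complete intersection if its minimal presentations (which all have the same finite cardinality) have $|A|-\dim_{\mathbb Q}(\mathbb Q S)$ elements. If $A=A_1\cup A_2$ is a partition of $A$ into two nonempty sets and $S_i=\langle A_i\rangle$, then $S$ is the gluing $S_1+_dS_2$ of $S_1$ and $S_2$ by $d$ if $d\in S_1\cap S_2$ and $\mathrm G(S_1)\cap \mathrm G(S_2)=d\mathbb Z$. **Theorem.** Let $S\neq\{0\}$ be a complete intersection affine semigroup with minimal generating system $A$. Then $S$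 has a Frobenius vector. More precisely, there are a partition $A=A_1\cup\dots\cup A_t$ into linearly independent sets and vectors $d_1,\dots,d_{t-1}$ such that, with $S_i=\langle A_i\rangle$, $$S=S_1+_{d_1}S_2+_{d_2}\cdots+_{d_{t-1}}S_t$$ for some bracketing of the right-hand side (that is, $S$ is obtained from $S_1,\dots,S_t$ by successive gluings of pairs), and for every such decomposition the vector $$\sum_{i=1}^{t-1}d_i-\sum_{a\in A}a$$ is a Frobenius vector of $S$. -/

import Mathlib

namespace AffineSemigroup

/-- The inclusion of `ℤ^m` in `ℚ^m`. -/
def toRat {m : ℕ} (v : Fin m → ℤ) : Fin m → ℚ := fun i => (v i : ℚ)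

/-- An affine semigroup: a finitely generated submonoid of `ℤ^m` that is contained in `ℕ^m`. -/
def IsAffineSemigroup {m : ℕ} (S : AddSubmonoid (Fin m → ℤ)) : Prop :=
  S.FG ∧ ∀ s ∈ S, 0 ≤ s

/-- `G(S)`, the subgroup of `ℤ^m` spanned by `S`. -/
def groupSpan {m : ℕ} (S : AddSubmonoid (Fin m → ℤ)) : AddSubgroup (Fin m → ℤ) :=
  AddSubgroup.closure (S : Set (Fin m → ℤ))

/-- `A` is a minimal generating system of the monoid `S`: it generates `S` and none of its proper
subsets does. An affine semigroup in `ℕ^m` has exactly one. -/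
def IsMinGen {m : ℕ} (A : Finset (Fin m → ℤ)) (S : AddSubmonoid (Fin m → ℤ)) : Prop :=
  AddSubmonoid.closure (A : Set (Fin m → ℤ)) = S ∧
    ∀ B : Finset (Fin m → ℤ), B ⊂ A → AddSubmonoid.closure (B : Set (Fin m → ℤ)) ≠ S

/-- The relative interior of the rational cone spanned by a finite set `A` of vectors: the
combinations of the elements of `A` in which all coefficients are positive rational numbers. -/
def relintConeOf {m : ℕ} (A : Finset (Fin m → ℤ)) : Set (Fin m → ℚ) :=
  {x | ∃ q : (Fin m → ℤ) → ℚ, (∀ a ∈ A, 0 < q a) ∧ x = ∑ a ∈ A, q a • toRat a}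

/-- The relative interior of `cone(S)`, that is, of the cone spanned by the minimal generating
system of `S`. -/
def relintCone {m : ℕ} (S : AddSubmonoid (Fin m → ℤ)) : Set (Fin m → ℚ) :=
  {x | ∃ A : Finset (Fin m → ℤ), IsMinGen A S ∧ x ∈ relintConeOf A}

/-- `f` is a Frobenius vector of `S`: `f ∈ G(S) \ S` and `f + (relint(cone(S)) ∩ G(S)) ⊆ S`. -/
def IsFrobeniusVector {m : ℕ} (S : AddSubmonoid (Fin m → ℤ)) (f : Fin m → ℤ) : Prop :=
  f ∈ groupSpan S ∧ f ∉ S ∧ ∀ x ∈ groupSpan S, toRat x ∈ relintCone S → f + x ∈ S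

/-- The monoid homomorphism `φ : ℕ^A → ℤ^m` that sends the basis vector of `a` to `a`. -/
def genHom {m : ℕ} (A : Finset (Fin m → ℤ)) : (A → ℕ) →+ (Fin m → ℤ) where
  toFun n := ∑ a : A, n a • (a : Fin m → ℤ)
  map_zero' := by simp
  map_add' x y := by simp [add_smul, Finset.sum_add_distrib]

/-- `ρ` is a presentation of `⟨A⟩` with respect to `A`: it generates the kernel congruence of
`φ : ℕ^A → ⟨A⟩`. -/
def IsPresentation {m : ℕ} (A : Finset (Fin m → ℤ)) (ρ : Finset ((A → ℕ) × (A → ℕ))) : Prop :=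
  addConGen (fun x y => (x, y) ∈ ρ) = AddCon.ker (genHom A)

/-- A presentation none of whose proper subsets is a presentation. -/
def IsMinimalPresentation {m : ℕ} (A : Finset (Fin m → ℤ))
    (ρ : Finset ((A → ℕ) × (A → ℕ))) : Prop :=
  IsPresentation A ρ ∧ ∀ σ : Finset ((A → ℕ) × (A → ℕ)), σ ⊂ ρ → ¬ IsPresentation A σ

/-- The dimension of the rational vector space spanned by `S`. -/
noncomputable def spanDim {m : ℕ} (S : AddSubmonoid (Fin m → ℤ)) : ℕ :=
  Module.finrank ℚ (Submodule.span ℚ (toRat '' (S : Set (Fin m → ℤ))))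

/-- `S` is a complete intersection: a minimal presentation of `S` has cardinality equal to the
embedding dimension of `S` minus the dimension of the vector space spanned by `S`. (All minimal
presentations of an affine semigroup are finite and have the same cardinality.) -/
def IsCompleteIntersection {m : ℕ} (S : AddSubmonoid (Fin m → ℤ)) : Prop :=
  ∃ A : Finset (Fin m → ℤ), IsMinGen A S ∧
    ∃ ρ : Finset ((A → ℕ) × (A → ℕ)), IsMinimalPresentation A ρ ∧ ρ.card + spanDim S = A.card

/-- `S = S₁ +_d S₂`, the gluing of `S₁` and `S₂` by `d`: the minimal generating system of `S` has
a nontrivial partition `A₁ ∪ A₂` with `Sᵢ = ⟨Aᵢ⟩`, the vector `d` lies in `S₁ ∩ S₂`, and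
`G(S₁) ∩ G(S₂) = dℤ`. -/
def IsGluing {m : ℕ} (S S₁ S₂ : AddSubmonoid (Fin m → ℤ)) (d : Fin m → ℤ) : Prop :=
  (∃ A₁ A₂ : Finset (Fin m → ℤ), IsMinGen (A₁ ∪ A₂) S ∧ Disjoint A₁ A₂ ∧
    A₁.Nonempty ∧ A₂.Nonempty ∧
    S₁ = AddSubmonoid.closure (A₁ : Set (Fin m → ℤ)) ∧
    S₂ = AddSubmonoid.closure (A₂ : Set (Fin m → ℤ))) ∧
  d ∈ S₁ ∧ d ∈ S₂ ∧ groupSpan S₁ ⊓ groupSpan S₂ = AddSubgroup.zmultiples d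

/-- `IsFreeGluing S [A₁, …, A_t] [d₁, …, d_{t-1}]` says that
`S = S₁ +_{d₁} S₂ +_{d₂} ⋯ +_{d_{t-1}} S_t` for some bracketing of the right-hand side, where
`Sᵢ = ⟨Aᵢ⟩` and every `Aᵢ` is linearly independent (for vectors of `ℤ^m`, independence over `ℤ`
and over `ℚ` are the same). -/
inductive IsFreeGluing {m : ℕ} : AddSubmonoid (Fin m → ℤ) → List (Finset (Fin m → ℤ)) →
    List (Fin m → ℤ) → Prop
  | free (S : AddSubmonoid (Fin m → ℤ)) (A : Finset (Fin m → ℤ)) (hA : IsMinGen A S)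
      (hli : LinearIndependent ℤ (fun a : A => (a : Fin m → ℤ))) : IsFreeGluing S [A] []
  | glue (S S₁ S₂ : AddSubmonoid (Fin m → ℤ)) (d : Fin m → ℤ)
      (P₁ P₂ : List (Finset (Fin m → ℤ))) (D₁ D₂ : List (Fin m → ℤ))
      (h : IsGluing S S₁ S₂ d) (h₁ : IsFreeGluing S₁ P₁ D₁) (h₂ : IsFreeGluing S₂ P₂ D₂) :
      IsFreeGluing S (P₁ ++ P₂) (D₁ ++ d :: D₂)

end AffineSemigroup

/-!
A semigroup generated by linearly independent vectors has the Frobenius vector `-∑ a`, and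
if `f₁`, `f₂` are Frobenius vectors of `S₁`, `S₂`, then `f₁ + f₂ + d` is one of the gluing
`S₁ +_d S₂` (`isFrobeniusVector_of_gluing`): an element of the group that lies in the relative
interior of the cone splits over the two groups, and the splitting is determined up to a rational
multiple of `d`, which can be rounded in favour of both summands. By induction every decomposition
into free semigroups by gluings gives a Frobenius vector (`IsFreeGluing.isFrobeniusVector`).

It remains to decompose a complete intersection `S`, and this is done on the matrix whose rows are
the differences `u - v` of the relations `(u, v)` in a minimal presentation.

* The matrix is dominating: no square submatrix has a positive and a negative entry in each
  of its rows (`card_filter_lt_card`). Suppose that a set `C` of columns violates this. Then at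
  least `|C|` of the binomials `x^u - x^v` vanish where the variables of `C` do, so these variables
  and the other binomials generate an ideal with at most as many generators as there are
  relations. By Krull's theorem a minimal prime over it has at most this number as its height. But
  it contains all binomials, hence the toric ideal, and properly so because of the variables; and
  the height of the toric ideal is at least the rank of the lattice of relations, which for a
  complete intersection is the number of relations.

* In a dominating matrix with at least one row, some row separates the others: the columns fall
  into two blocks, the row is nonnegative on one and nonpositive on the other, and all other rows
  live in one of the blocks (`exists_separates`). This is an induction on the number of rows. Remove
  a row `i`; another row `j` separates the rest. Inside each of the two blocks of `j` the
  rows `i` and `j` can be replaced by a single new row. If this keeps the system dominating, then by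
  induction it has a separating row, and this gives one for the whole system. If it does not, there
  is a tight set of columns joining the two parts of the new row, and combining tight sets from
  the two blocks with `i` and `j` contradicts domination.

* A separating relation `w` with blocks `A₁`, `A₂` makes `⟨A⟩` the gluing of `⟨A₁⟩` and `⟨A₂⟩` by
  `d = ∑_{a ∈ A₁} w_a a`, and the relations inside a block again form a dominating system that
  generates all relations of this block (`IsDominatingRelations.exists_isFreeGluing`). When no
  relation is left, the generators are linearly independent.
-/

namespace AffineSemigroup

/-! ### Dominating systems of signed rows -/

/-- A signed row `(P, N)`, consisting of a positive part `P` and a negative part `N`, is mixed on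
a set of columns `C` if both parts meet `C`. -/
def MixedOn {V : Type*} (C : Finset V) (k : Finset V × Finset V) : Prop :=
  (∃ p ∈ C, p ∈ k.1) ∧ ∃ q ∈ C, q ∈ k.2

open scoped Classical in
/-- A set of signed rows is dominating if every nonempty set `C` of columns carries fewer than
`|C|` rows that are mixed on it; equivalently, no square submatrix has only mixed rows. -/
def Dominating {V : Type*} (R : Finset (Finset V × Finset V)) : Prop :=
  ∀ C : Finset V, C.Nonempty → (R.filter (MixedOn C)).card < C.card

/-- The signed row `k` vanishes outside the set of columns `C`. -/
def RowIn {V : Type*} (C : Set V) (k : Finset V × Finset V) : Prop :=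
  (∀ v ∈ k.1, v ∈ C) ∧ ∀ v ∈ k.2, v ∈ C

/-- The row `i` separates the rows `R`: the columns split into two blocks, the positive part of `i`
lies in one and its negative part in the other, and every other row lies in one of the blocks. -/
def Separates {V : Type*} (R : Finset (Finset V × Finset V)) (i : Finset V × Finset V) : Prop :=
  ∃ C : Set V, (∀ v ∈ i.1, v ∈ C) ∧ (∀ v ∈ i.2, v ∉ C) ∧
    ∀ j ∈ R, j ≠ i → RowIn C j ∨ RowIn Cᶜ j

section Combinatorics

variable {V : Type*}

theorem MixedOn.mono {C D : Finset V} {k : Finset V × Finset V} (h : C ⊆ D) (hk : MixedOn C k) :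
    MixedOn D k := by
  obtain ⟨⟨p, hp, hp'⟩, q, hq, hq'⟩ := hk
  exact ⟨⟨p, h hp, hp'⟩, q, h hq, hq'⟩

/-- Blocks may be exchanged, so the signs of the separating row do not matter. -/
theorem Separates.of_swap {R : Finset (Finset V × Finset V)} {i : Finset V × Finset V} (C : Set V)
    (h₁ : ∀ v ∈ i.1, v ∉ C) (h₂ : ∀ v ∈ i.2, v ∈ C)
    (h : ∀ j ∈ R, j ≠ i → RowIn C j ∨ RowIn Cᶜ j) : Separates R i :=
  ⟨Cᶜ, h₁, fun v hv hv' => hv' (h₂ v hv), fun j hj hji => by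
    rw [compl_compl]; exact (h j hj hji).symm⟩

open scoped Classical in
/-- If the row `k` cannot be added to `M` as a new row without destroying domination, then `k` is
mixed on a set `C` that is tight for `M`, that is, carries `|C| - 1` mixed rows of `M`. -/
theorem exists_tight_of_not_dominating_insert {M : Finset (Finset V × Finset V)}
    {k : Finset V × Finset V} (hM : Dominating M) (hk₁ : k.1.Nonempty) (hk₂ : k.2.Nonempty)
    (h : ¬ (k ∉ M ∧ Dominating (insert k M))) :
    ∃ C : Finset V, C.card ≤ (M.filter (MixedOn C)).card + 1 ∧ MixedOn C k := by
  by_cases hkM : k ∈ M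
  · obtain ⟨p, hp⟩ := hk₁
    obtain ⟨q, hq⟩ := hk₂
    have hmix : MixedOn {p, q} k := ⟨⟨p, by simp, hp⟩, q, by simp, hq⟩
    have hpos : 0 < (M.filter (MixedOn {p, q})).card :=
      Finset.card_pos.2 ⟨k, Finset.mem_filter.2 ⟨hkM, hmix⟩⟩
    have := Finset.card_le_two (a := p) (b := q)
    exact ⟨{p, q}, by omega, hmix⟩
  replace h : ¬ Dominating (insert k M) := fun h' => h ⟨hkM, h'⟩
  unfold Dominating at h
  push Not at h
  obtain ⟨C, hC, hcard⟩ := h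
  have h1 := hM C hC
  by_cases hk : MixedOn C k
  · refine ⟨C, ?_, hk⟩
    rw [Finset.filter_insert, if_pos hk] at hcard
    exact hcard.trans (Finset.card_insert_le _ _)
  · rw [Finset.filter_insert, if_neg hk] at hcard
    omega

open scoped Classical in
theorem Dominating.mono {M R : Finset (Finset V × Finset V)} (h : M ⊆ R) (hR : Dominating R) :
    Dominating M := fun C hC =>
  (Finset.card_le_card (Finset.filter_subset_filter _ h)).trans_lt (hR C hC)

open scoped Classical in
/-- One side of the separation argument. The rows `M` live in the block `C₁`, and the other rows
of `R` touch `C₁` only in `X ∪ Y`. A separating row of `M` together with the new row `(X, Y)`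
either separates all of `R`, or is `(X, Y)` itself and then splits `C₁` into two
blocks of `M`, one containing `X` and the other, `D`, containing `Y`. -/
theorem separates_or_exists_split {R M : Finset (Finset V × Finset V)} (hMR : M ⊆ R)
    {C₁ : Set V} (hM : ∀ k ∈ M, RowIn C₁ k) {X Y : Finset V} (hY : ∀ v ∈ Y, v ∈ C₁)
    (hR : ∀ k ∈ R, k ∉ M → ∀ v ∈ C₁, v ∈ k.1 ∨ v ∈ k.2 → v ∈ X ∨ v ∈ Y)
    (hsep : Y.Nonempty →
      (X, Y) ∉ M ∧ ∃ l ∈ insert (X, Y) M, Separates (insert (X, Y) M) l) :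
    (∃ l ∈ R, Separates R l) ∨
      ∃ D : Set V, D ⊆ C₁ ∧ (∀ v ∈ Y, v ∈ D) ∧ (∀ v ∈ X, v ∉ D) ∧
        ∀ k ∈ M, RowIn D k ∨ RowIn Dᶜ k := by
  rcases Y.eq_empty_or_nonempty with rfl | hYne
  · exact Or.inr ⟨∅, by simp, by simp, by simp, fun k _ => Or.inr ⟨by simp, by simp⟩⟩
  obtain ⟨hXYM, l, hl, E, hl1, hl2, hE⟩ := hsep hYne
  by_cases hlk : l = (X, Y)
  · subst hlk
    refine Or.inr ⟨Eᶜ ∩ C₁, Set.inter_subset_right, fun v hv => ⟨hl2 v hv, hY v hv⟩,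
      fun v hv h => h.1 (hl1 v hv), fun k hk => ?_⟩
    rcases hE k (Finset.mem_insert_of_mem hk) (ne_of_mem_of_not_mem hk hXYM) with h | h
    · exact Or.inr ⟨fun v hv h' => h'.1 (h.1 v hv), fun v hv h' => h'.1 (h.2 v hv)⟩
    · exact Or.inl ⟨fun v hv => ⟨h.1 v hv, (hM k hk).1 v hv⟩,
        fun v hv => ⟨h.2 v hv, (hM k hk).2 v hv⟩⟩
  · left
    have hlM : l ∈ M := (Finset.mem_insert.1 hl).resolve_left hlk
    refine ⟨l, hMR hlM, ?_⟩
    -- The part of `C₁` on the side of `E` that avoids the new row is a block of all of `R`.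
    have block : ∀ F : Set V, RowIn Fᶜ (X, Y) → (∀ k ∈ M, k ≠ l → RowIn F k ∨ RowIn Fᶜ k) →
        ∀ k ∈ R, k ≠ l → RowIn (F ∩ C₁) k ∨ RowIn (F ∩ C₁)ᶜ k := by
      intro F hF hFM k hk hkl
      by_cases hkM : k ∈ M
      · rcases hFM k hkM hkl with h | h
        · exact Or.inl ⟨fun v hv => ⟨h.1 v hv, (hM k hkM).1 v hv⟩,
            fun v hv => ⟨h.2 v hv, (hM k hkM).2 v hv⟩⟩
        · exact Or.inr ⟨fun v hv h' => h.1 v hv h'.1, fun v hv h' => h.2 v hv h'.1⟩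
      · have key : ∀ v, v ∈ k.1 ∨ v ∈ k.2 → v ∉ F ∩ C₁ := fun v hv hvF =>
          (hR k hk hkM v hvF.2 hv).elim (fun h => hF.1 v h hvF.1) fun h => hF.2 v h hvF.1
        exact Or.inr ⟨fun v hv => key v (Or.inl hv), fun v hv => key v (Or.inr hv)⟩
    rcases hE _ (Finset.mem_insert_self _ _) (Ne.symm hlk) with h | h
    · refine Separates.of_swap (Eᶜ ∩ C₁) (fun v hv h' => h'.1 (hl1 v hv))
        (fun v hv => ⟨hl2 v hv, (hM l hlM).2 v hv⟩) (block Eᶜ (by rwa [compl_compl]) ?_)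
      intro k hk hkl
      rw [compl_compl]
      exact (hE k (Finset.mem_insert_of_mem hk) hkl).symm
    · exact ⟨E ∩ C₁, fun v hv => ⟨hl1 v hv, (hM l hlM).1 v hv⟩, fun v hv h' => hl2 v hv h'.1,
        block E h fun k hk hkl => hE k (Finset.mem_insert_of_mem hk) hkl⟩

open scoped Classical in
/-- Two disjoint families of rows that are tight on `C` and `C'` respectively leave no room for two
further rows that are mixed on `C ∪ C'`. -/
theorem Dominating.false_of_tight_union {R M₁ M₂ : Finset (Finset V × Finset V)}
    (hR : Dominating R) (h₁ : M₁ ⊆ R) (h₂ : M₂ ⊆ R) (hd : Disjoint M₁ M₂)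
    {i j : Finset V × Finset V} (hi : i ∈ R) (hj : j ∈ R) (hij : i ≠ j) (hi₁ : i ∉ M₁)
    (hi₂ : i ∉ M₂) (hj₁ : j ∉ M₁) (hj₂ : j ∉ M₂) {C C' : Finset V}
    (hC : C.card ≤ (M₁.filter (MixedOn C)).card + 1)
    (hC' : C'.card ≤ (M₂.filter (MixedOn C')).card + 1)
    (himix : MixedOn (C ∪ C') i) (hjmix : MixedOn (C ∪ C') j) : False := by
  have hne : (C ∪ C').Nonempty := let ⟨⟨p, hp, _⟩, _⟩ := himix; ⟨p, hp⟩
  have h := hR _ hne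
  have hsub : insert i (insert j (M₁.filter (MixedOn C) ∪ M₂.filter (MixedOn C'))) ⊆
      R.filter (MixedOn (C ∪ C')) := by
    intro k hk
    simp only [Finset.mem_insert, Finset.mem_union, Finset.mem_filter] at hk ⊢
    rcases hk with rfl | rfl | ⟨hk, hk'⟩ | ⟨hk, hk'⟩
    · exact ⟨hi, himix⟩
    · exact ⟨hj, hjmix⟩
    · exact ⟨h₁ hk, hk'.mono Finset.subset_union_left⟩
    · exact ⟨h₂ hk, hk'.mono Finset.subset_union_right⟩
  have hcard := Finset.card_le_card hsub
  rw [Finset.card_insert_of_notMem (by simp [hij, hi₁, hi₂]),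
    Finset.card_insert_of_notMem (by simp [hj₁, hj₂]),
    Finset.card_union_of_disjoint (Finset.disjoint_filter_filter hd)] at hcard
  have := Finset.card_union_le C C'
  omega

open scoped Classical in
/-- A family of rows that is tight on `C` leaves no room for a further row mixed on `C`. -/
theorem Dominating.false_of_tight {R M : Finset (Finset V × Finset V)} (hR : Dominating R)
    (hM : M ⊆ R) {i : Finset V × Finset V} (hi : i ∈ R) (hiM : i ∉ M) {C : Finset V}
    (hC : C.card ≤ (M.filter (MixedOn C)).card + 1) (himix : MixedOn C i) : False := by
  have hne : C.Nonempty := let ⟨⟨p, hp, _⟩, _⟩ := himix; ⟨p, hp⟩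
  have h := hR _ hne
  have hsub : insert i (M.filter (MixedOn C)) ⊆ R.filter (MixedOn C) := by
    intro k hk
    simp only [Finset.mem_insert, Finset.mem_filter] at hk ⊢
    rcases hk with rfl | ⟨hk, hk'⟩
    · exact ⟨hi, himix⟩
    · exact ⟨hM hk, hk'⟩
  have hcard := Finset.card_le_card hsub
  rw [Finset.card_insert_of_notMem (by simp [hiM])] at hcard
  omega

open scoped Classical in
/-- The decomposition theorem for dominating systems of mixed rows: one of the rows separates
the others. -/
theorem exists_separates (R : Finset (Finset V × Finset V)) (hRne : R.Nonempty)
    (hmix : ∀ k ∈ R, k.1.Nonempty ∧ k.2.Nonempty) (hR : Dominating R) :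
    ∃ l ∈ R, Separates R l := by
  induction hn : R.card using Nat.strong_induction_on generalizing R with
  | _ n IH =>
  subst hn
  obtain ⟨i, hi⟩ := hRne
  have hRi : (R.erase i).card < R.card := Finset.card_erase_lt_of_mem hi
  rcases (R.erase i).eq_empty_or_nonempty with hempty | hne
  · -- A single row separates itself, its two signs being disjoint.
    refine ⟨i, hi, (i.1 : Set V), fun v hv => hv, fun v hv hv' => ?_, fun j hj hji => ?_⟩
    · exact hR.false_of_tight (M := ∅) (by simp) hi (by simp) (C := {v}) (by simp)
        ⟨⟨v, by simp, hv'⟩, v, by simp, hv⟩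
    · exact absurd (Finset.mem_erase.2 ⟨hji, hj⟩) (by simp [hempty])
  obtain ⟨j, hj, C₁, hj1, hj2, hsep⟩ := IH _ hRi (R.erase i) hne
    (fun k hk => hmix k (Finset.mem_of_mem_erase hk)) (hR.mono (Finset.erase_subset _ _)) rfl
  obtain ⟨hji, hjR⟩ := Finset.mem_erase.1 hj
  set M₁ := ((R.erase i).erase j).filter (RowIn C₁) with hM₁
  set M₂ := ((R.erase i).erase j).filter (RowIn C₁ᶜ) with hM₂
  have hM₁' : ∀ k, k ∈ M₁ ↔ (k ≠ j ∧ k ≠ i ∧ k ∈ R) ∧ RowIn C₁ k := fun k => by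
    simp [hM₁]
  have hM₂' : ∀ k, k ∈ M₂ ↔ (k ≠ j ∧ k ≠ i ∧ k ∈ R) ∧ RowIn C₁ᶜ k := fun k => by
    simp [hM₂]
  have hM₁R : M₁ ⊆ R := fun k hk => ((hM₁' k).1 hk).1.2.2
  have hM₂R : M₂ ⊆ R := fun k hk => ((hM₂' k).1 hk).1.2.2
  have hdisj : Disjoint M₁ M₂ := by
    rw [Finset.disjoint_left]
    intro k hk hk'
    obtain ⟨p, hp⟩ := (hmix k (hM₁R hk)).1
    exact ((hM₂' k).1 hk').2.1 p hp (((hM₁' k).1 hk).2.1 p hp)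
  have hi₁ : i ∉ M₁ := fun h => ((hM₁' i).1 h).1.2.1 rfl
  have hi₂ : i ∉ M₂ := fun h => ((hM₂' i).1 h).1.2.1 rfl
  have hj₁ : j ∉ M₁ := fun h => ((hM₁' j).1 h).1.1 rfl
  have hj₂ : j ∉ M₂ := fun h => ((hM₂' j).1 h).1.1 rfl
  have hcases : ∀ k ∈ R, k = i ∨ k = j ∨ k ∈ M₁ ∨ k ∈ M₂ := by
    intro k hk
    by_cases hki : k = i
    · exact Or.inl hki
    by_cases hkj : k = j
    · exact Or.inr (Or.inl hkj)
    rcases hsep k (Finset.mem_erase.2 ⟨hki, hk⟩) hkj with h | h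
    · exact Or.inr (Or.inr (Or.inl ((hM₁' k).2 ⟨⟨hkj, hki, hk⟩, h⟩)))
    · exact Or.inr (Or.inr (Or.inr ((hM₂' k).2 ⟨⟨hkj, hki, hk⟩, h⟩)))
  have hcard : ∀ M, M ⊆ R → i ∉ M → j ∉ M → ∀ k, (insert k M).card < R.card := by
    intro M hM hiM hjM k
    have h1 : insert i (insert j M) ⊆ R :=
      Finset.insert_subset hi (Finset.insert_subset hjR hM)
    have h2 := Finset.card_le_card h1
    rw [Finset.card_insert_of_notMem (by simp [hji.symm, hiM]),
      Finset.card_insert_of_notMem hjM] at h2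
    have := Finset.card_insert_le k M
    omega
  by_cases hdone : ∃ l ∈ R, Separates R l
  · exact hdone
  -- A block with rows `M` either splits between `X` and `Y`, or has a tight set joining them.
  have side : ∀ (B : Set V) (M : Finset (Finset V × Finset V)), M ⊆ R → i ∉ M → j ∉ M →
      (∀ k ∈ M, RowIn B k) → ∀ X Y : Finset V, X.Nonempty → (∀ v ∈ Y, v ∈ B) →
      (∀ k ∈ R, k ∉ M → ∀ v ∈ B, v ∈ k.1 ∨ v ∈ k.2 → v ∈ X ∨ v ∈ Y) →
      (∃ D : Set V, D ⊆ B ∧ (∀ v ∈ Y, v ∈ D) ∧ (∀ v ∈ X, v ∉ D) ∧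
        ∀ k ∈ M, RowIn D k ∨ RowIn Dᶜ k) ∨
      ∃ C : Finset V, C.card ≤ (M.filter (MixedOn C)).card + 1 ∧ MixedOn C (X, Y) := by
    intro B M hMR hiM hjM hMB X Y hX hYB hcover
    by_cases hY : Y.Nonempty
    · by_cases hins : (X, Y) ∉ M ∧ Dominating (insert (X, Y) M)
      · refine Or.inl ((separates_or_exists_split hMR hMB hYB hcover fun _ =>
          ⟨hins.1, IH _ (hcard M hMR hiM hjM _) _ (Finset.insert_nonempty _ _) ?_ hins.2
            rfl⟩).resolve_left hdone)
        intro k hk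
        rcases Finset.mem_insert.1 hk with rfl | hk
        · exact ⟨hX, hY⟩
        · exact hmix k (hMR hk)
      · exact Or.inr (exists_tight_of_not_dominating_insert (hR.mono hMR) hX hY hins)
    · exact Or.inl ((separates_or_exists_split hMR hMB hYB hcover
        fun h => absurd h hY).resolve_left hdone)
  have side₁ := side C₁ M₁ hM₁R hi₁ hj₁ fun k hk => ((hM₁' k).1 hk).2
  have side₂ := side C₁ᶜ M₂ hM₂R hi₂ hj₂ fun k hk => ((hM₂' k).1 hk).2
  -- How the rows outside a block meet it.
  have hcover₁ : ∀ k ∈ R, k ∉ M₁ → ∀ v ∈ C₁, v ∈ k.1 ∨ v ∈ k.2 →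
      v ∈ j.1 ∨ v ∈ i.1 ∨ v ∈ i.2 := by
    intro k hk hkM v hv hvk
    rcases hcases k hk with rfl | rfl | h | h
    · exact Or.inr hvk
    · exact hvk.elim Or.inl fun h => absurd hv (hj2 v h)
    · exact absurd h hkM
    · exact absurd hv (hvk.elim (((hM₂' k).1 h).2.1 v) (((hM₂' k).1 h).2.2 v))
  have hcover₂ : ∀ k ∈ R, k ∉ M₂ → ∀ v ∈ C₁ᶜ, v ∈ k.1 ∨ v ∈ k.2 →
      v ∈ j.2 ∨ v ∈ i.1 ∨ v ∈ i.2 := by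
    intro k hk hkM v hv hvk
    rcases hcases k hk with rfl | rfl | h | h
    · exact Or.inr hvk
    · exact hvk.elim (fun h => absurd (hj1 v h) hv) Or.inl
    · exact absurd (hvk.elim (((hM₁' k).1 h).2.1 v) (((hM₁' k).1 h).2.2 v)) hv
    · exact absurd h hkM
  -- A tight set in each block joins the row `j` to the row `i`, since `j` does not separate.
  obtain ⟨T₁, hT₁, ⟨p₁, hp₁, hp₁j⟩, q₁, hq₁, hq₁i⟩ := (side₁ j.1
    ((i.1 ∪ i.2).filter (· ∈ C₁)) (hmix j hjR).1 (by simp) (by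
      intro k hk hkM v hv hvk
      have := hcover₁ k hk hkM v hv hvk
      simpa [hv] using this)).resolve_left (by
    rintro ⟨D, hDC, hD1, hD2, hD3⟩
    refine hdone ⟨j, hjR, C₁ \ D, fun v hv => ⟨hj1 v hv, hD2 v hv⟩,
      fun v hv h => hj2 v hv h.1, fun k hk hkj => ?_⟩
    rcases hcases k hk with rfl | rfl | h | h
    · have key : ∀ v, v ∈ k.1 ∨ v ∈ k.2 → v ∉ C₁ \ D := fun v hv h =>
        h.2 (hD1 v (by simpa [h.1] using hv))
      exact Or.inr ⟨fun v hv => key v (Or.inl hv), fun v hv => key v (Or.inr hv)⟩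
    · exact absurd rfl hkj
    · rcases hD3 k h with h' | h'
      · exact Or.inr ⟨fun v hv h => h.2 (h'.1 v hv), fun v hv h => h.2 (h'.2 v hv)⟩
      · have := ((hM₁' k).1 h).2
        exact Or.inl ⟨fun v hv => ⟨this.1 v hv, h'.1 v hv⟩,
          fun v hv => ⟨this.2 v hv, h'.2 v hv⟩⟩
    · have := ((hM₂' k).1 h).2
      exact Or.inr ⟨fun v hv h => this.1 v hv h.1, fun v hv h => this.2 v hv h.1⟩)
  obtain ⟨T₂, hT₂, ⟨p₂, hp₂, hp₂j⟩, q₂, hq₂, hq₂i⟩ := (side₂ j.2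
    ((i.1 ∪ i.2).filter (· ∈ C₁ᶜ)) (hmix j hjR).2 (by simp) (by
      intro k hk hkM v hv hvk
      have := hcover₂ k hk hkM v hv hvk
      have hv' : v ∉ C₁ := hv
      simpa [hv'] using this)).resolve_left (by
    rintro ⟨D, hDC, hD1, hD2, hD3⟩
    refine hdone ⟨j, hjR, Separates.of_swap (C₁ᶜ \ D) (fun v hv h => h.1 (hj1 v hv))
      (fun v hv => ⟨hj2 v hv, hD2 v hv⟩) fun k hk hkj => ?_⟩
    rcases hcases k hk with rfl | rfl | h | h
    · have key : ∀ v, v ∈ k.1 ∨ v ∈ k.2 → v ∉ C₁ᶜ \ D := fun v hv h =>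
        h.2 (hD1 v (by
          have h1 : v ∉ C₁ := h.1
          simpa [h1] using hv))
      exact Or.inr ⟨fun v hv => key v (Or.inl hv), fun v hv => key v (Or.inr hv)⟩
    · exact absurd rfl hkj
    · have := ((hM₁' k).1 h).2
      exact Or.inr ⟨fun v hv h => h.1 (this.1 v hv), fun v hv h => h.1 (this.2 v hv)⟩
    · rcases hD3 k h with h' | h'
      · exact Or.inr ⟨fun v hv h => h.2 (h'.1 v hv), fun v hv h => h.2 (h'.2 v hv)⟩
      · have := ((hM₂' k).1 h).2
        exact Or.inl ⟨fun v hv => ⟨this.1 v hv, h'.1 v hv⟩,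
          fun v hv => ⟨this.2 v hv, h'.2 v hv⟩⟩)
  have hq₁i' : q₁ ∈ i.1 ∨ q₁ ∈ i.2 := by
    have := (Finset.mem_filter.1 hq₁i).1
    simpa using this
  have hq₂i' : q₂ ∈ i.1 ∨ q₂ ∈ i.2 := by
    have := (Finset.mem_filter.1 hq₂i).1
    simpa using this
  -- Tight sets in the two blocks that join `j` to `i` do so with the same sign of `i`.
  have cross : ∀ S₁ S₂ : Finset V, S₁.card ≤ (M₁.filter (MixedOn S₁)).card + 1 →
      S₂.card ≤ (M₂.filter (MixedOn S₂)).card + 1 → (∃ p ∈ S₁, p ∈ j.1) →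
      (∃ p ∈ S₂, p ∈ j.2) → (∃ q ∈ S₁ ∪ S₂, q ∈ i.1) → (∃ q ∈ S₁ ∪ S₂, q ∈ i.2) → False := by
    rintro S₁ S₂ hS₁ hS₂ ⟨a, ha, ha'⟩ ⟨b, hb, hb'⟩ h1 h2
    exact hR.false_of_tight_union hM₁R hM₂R hdisj hi hjR hji.symm hi₁ hi₂ hj₁ hj₂ hS₁ hS₂
      ⟨h1, h2⟩ ⟨⟨a, Finset.mem_union_left _ ha, ha'⟩, b, Finset.mem_union_right _ hb, hb'⟩
  -- If the sign `A` of `i` is joined to `j` in both blocks, the opposite sign `B` is joined in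
  -- neither block to `j` or to `A`, so both blocks split and `i` separates.
  have final : ∀ A B : Finset V, (A = i.1 ∧ B = i.2) ∨ (A = i.2 ∧ B = i.1) → q₁ ∈ A → q₂ ∈ A →
      False := by
    intro A B hAB hqA₁ hqA₂
    have mixAB : ∀ S : Finset V, (∃ p ∈ S, p ∈ A) → (∃ q ∈ S, q ∈ B) → MixedOn S i := by
      rintro S h1 h2
      rcases hAB with ⟨rfl, rfl⟩ | ⟨rfl, rfl⟩
      · exact ⟨h1, h2⟩
      · exact ⟨h2, h1⟩
    have suppAB : ∀ v, v ∈ i.1 ∨ v ∈ i.2 → v ∈ A ∨ v ∈ B := by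
      intro v hv
      rcases hAB with ⟨rfl, rfl⟩ | ⟨rfl, rfl⟩
      · exact hv
      · exact hv.symm
    obtain ⟨D₁, hDC₁, hDB₁, hDA₁, hDM₁⟩ := (side₁ (j.1 ∪ A.filter (· ∈ C₁))
      (B.filter (· ∈ C₁)) ((hmix j hjR).1.mono Finset.subset_union_left) (by simp) (by
        intro k hk hkM v hv hvk
        rcases hcover₁ k hk hkM v hv hvk with h | h
        · exact Or.inl (Finset.mem_union_left _ h)
        · exact (suppAB v h).imp
            (fun h => Finset.mem_union_right _ (Finset.mem_filter.2 ⟨h, hv⟩))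
            fun h => Finset.mem_filter.2 ⟨h, hv⟩)).resolve_right (by
      rintro ⟨S, hS, ⟨p, hp, hp'⟩, q, hq, hq'⟩
      have hqB := (Finset.mem_filter.1 hq').1
      rcases Finset.mem_union.1 hp' with hp' | hp'
      · have := mixAB (S ∪ T₂) ⟨q₂, Finset.mem_union_right _ hq₂, hqA₂⟩
          ⟨q, Finset.mem_union_left _ hq, hqB⟩
        exact cross S T₂ hS hT₂ ⟨p, hp, hp'⟩ ⟨p₂, hp₂, hp₂j⟩ this.1 this.2
      · exact hR.false_of_tight hM₁R hi hi₁ hS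
          (mixAB S ⟨p, hp, (Finset.mem_filter.1 hp').1⟩ ⟨q, hq, hqB⟩))
    obtain ⟨D₂, hDC₂, hDB₂, hDA₂, hDM₂⟩ := (side₂ (j.2 ∪ A.filter (· ∈ C₁ᶜ))
      (B.filter (· ∈ C₁ᶜ)) ((hmix j hjR).2.mono Finset.subset_union_left) (by simp) (by
        intro k hk hkM v hv hvk
        rcases hcover₂ k hk hkM v hv hvk with h | h
        · exact Or.inl (Finset.mem_union_left _ h)
        · exact (suppAB v h).imp
            (fun h => Finset.mem_union_right _ (Finset.mem_filter.2 ⟨h, hv⟩))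
            fun h => Finset.mem_filter.2 ⟨h, hv⟩)).resolve_right (by
      rintro ⟨S, hS, ⟨p, hp, hp'⟩, q, hq, hq'⟩
      have hqB := (Finset.mem_filter.1 hq').1
      rcases Finset.mem_union.1 hp' with hp' | hp'
      · have := mixAB (T₁ ∪ S) ⟨q₁, Finset.mem_union_left _ hq₁, hqA₁⟩
          ⟨q, Finset.mem_union_right _ hq, hqB⟩
        exact cross T₁ S hT₁ hS ⟨p₁, hp₁, hp₁j⟩ ⟨p, hp, hp'⟩ this.1 this.2
      · exact hR.false_of_tight hM₂R hi hi₂ hS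
          (mixAB S ⟨p, hp, (Finset.mem_filter.1 hp').1⟩ ⟨q, hq, hqB⟩))
    have hB : ∀ v ∈ B, v ∈ D₁ ∪ D₂ := by
      intro v hv
      by_cases hvC : v ∈ C₁
      · exact Or.inl (hDB₁ v (by simp [hv, hvC]))
      · exact Or.inr (hDB₂ v (by simp [hv, hvC]))
    have hA : ∀ v ∈ A, v ∉ D₁ ∪ D₂ := by
      rintro v hv (h | h)
      · exact hDA₁ v (by simp [hv, hDC₁ h]) h
      · have := hDC₂ h
        exact hDA₂ v (by simpa [hv] using Or.inr this) h
    have hrest : ∀ k ∈ R, k ≠ i → RowIn (D₁ ∪ D₂) k ∨ RowIn (D₁ ∪ D₂)ᶜ k := by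
      intro k hk hki
      rcases hcases k hk with rfl | rfl | h | h
      · exact absurd rfl hki
      · refine Or.inr ⟨?_, ?_⟩
        · rintro v hv (h | h)
          · exact hDA₁ v (by simp [hv]) h
          · exact hDC₂ h (hj1 v hv)
        · rintro v hv (h | h)
          · exact hj2 v hv (hDC₁ h)
          · exact hDA₂ v (by simp [hv]) h
      · have hk' := ((hM₁' k).1 h).2
        rcases hDM₁ k h with h' | h'
        · exact Or.inl ⟨fun v hv => Or.inl (h'.1 v hv), fun v hv => Or.inl (h'.2 v hv)⟩
        · refine Or.inr ⟨?_, ?_⟩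
          · rintro v hv (h | h)
            exacts [h'.1 v hv h, hDC₂ h (hk'.1 v hv)]
          · rintro v hv (h | h)
            exacts [h'.2 v hv h, hDC₂ h (hk'.2 v hv)]
      · have hk' := ((hM₂' k).1 h).2
        rcases hDM₂ k h with h' | h'
        · exact Or.inl ⟨fun v hv => Or.inr (h'.1 v hv), fun v hv => Or.inr (h'.2 v hv)⟩
        · refine Or.inr ⟨?_, ?_⟩
          · rintro v hv (h | h)
            exacts [hk'.1 v hv (hDC₁ h), h'.1 v hv h]
          · rintro v hv (h | h)
            exacts [hk'.2 v hv (hDC₁ h), h'.2 v hv h]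
    rcases hAB with ⟨rfl, rfl⟩ | ⟨rfl, rfl⟩
    · exact hdone ⟨i, hi, Separates.of_swap (D₁ ∪ D₂) hA hB hrest⟩
    · exact hdone ⟨i, hi, D₁ ∪ D₂, hB, hA, hrest⟩
  exfalso
  have hj₁' : ∃ p ∈ T₁, p ∈ j.1 := ⟨p₁, hp₁, hp₁j⟩
  have hj₂' : ∃ p ∈ T₂, p ∈ j.2 := ⟨p₂, hp₂, hp₂j⟩
  have hm₁ : q₁ ∈ T₁ ∪ T₂ := Finset.mem_union_left _ hq₁
  have hm₂ : q₂ ∈ T₁ ∪ T₂ := Finset.mem_union_right _ hq₂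
  rcases hq₁i' with h1 | h1 <;> rcases hq₂i' with h2 | h2
  · exact final i.1 i.2 (Or.inl ⟨rfl, rfl⟩) h1 h2
  · exact cross T₁ T₂ hT₁ hT₂ hj₁' hj₂' ⟨q₁, hm₁, h1⟩ ⟨q₂, hm₂, h2⟩
  · exact cross T₁ T₂ hT₁ hT₂ hj₁' hj₂' ⟨q₂, hm₂, h2⟩ ⟨q₁, hm₁, h1⟩
  · exact final i.2 i.1 (Or.inr ⟨rfl, rfl⟩) h1 h2

end Combinatorics

/-! ### Minimal generating systems and Frobenius vectors of gluings -/

section MinimalGenerators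

variable {m : ℕ} {A B : Finset (Fin m → ℤ)} {S : AddSubmonoid (Fin m → ℤ)}

theorem IsMinGen.subset (hA : IsMinGen A S) (hBA : B ⊆ A) :
    IsMinGen B (AddSubmonoid.closure (B : Set (Fin m → ℤ))) := by
  classical
  refine ⟨rfl, fun B' hB' h => hA.2 (B' ∪ (A \ B)) ?_ ?_⟩
  · obtain ⟨b, hb, hb'⟩ := (Finset.ssubset_iff_of_subset hB'.1).1 hB'
    refine (Finset.ssubset_iff_of_subset (Finset.union_subset (hB'.1.trans hBA)
      Finset.sdiff_subset)).2 ⟨b, hBA hb, ?_⟩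
    simp [hb, hb']
  · rw [← hA.1, Finset.coe_union, AddSubmonoid.closure_union, h, ← AddSubmonoid.closure_union,
      ← Finset.coe_union, Finset.union_sdiff_of_subset hBA]

theorem IsMinGen.zero_notMem (hA : IsMinGen A S) : (0 : Fin m → ℤ) ∉ A := by
  classical
  intro h
  refine hA.2 (A.erase 0) (Finset.erase_ssubset h) ?_
  rw [← hA.1]
  conv_rhs => rw [← Finset.insert_erase h, Finset.coe_insert, Set.insert_eq,
    AddSubmonoid.closure_union, AddSubmonoid.closure_singleton_zero, bot_sup_eq]

theorem IsMinGen.mem (hA : IsMinGen A S) {a : Fin m → ℤ} (ha : a ∈ A) : a ∈ S :=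
  hA.1 ▸ AddSubmonoid.subset_closure ha

theorem nonneg_of_mem_closure (hA : ∀ a ∈ A, 0 ≤ a) {s : Fin m → ℤ}
    (hs : s ∈ AddSubmonoid.closure (A : Set (Fin m → ℤ))) : 0 ≤ s := by
  induction hs using AddSubmonoid.closure_induction with
  | mem x hx => exact hA x hx
  | zero => exact le_rfl
  | add x y _ _ hx hy => exact add_nonneg hx hy

/-- In a semigroup of nonnegative vectors, the elements of a minimal generating system are atoms. -/
theorem IsMinGen.eq_zero_or_eq_zero_of_add_mem (hS : ∀ s ∈ S, 0 ≤ s) (hA : IsMinGen A S)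
    {s t : Fin m → ℤ} (hs : s ∈ S) (ht : t ∈ S) (hst : s + t ∈ A) : s = 0 ∨ t = 0 := by
  classical
  set a := s + t with ha
  have key : ∀ x ∈ S, x ∈ AddSubmonoid.closure ((A.erase a : Finset _) : Set (Fin m → ℤ)) ∨
      a ≤ x := by
    intro x hx
    rw [← hA.1] at hx
    induction hx using AddSubmonoid.closure_induction with
    | mem x hx =>
      by_cases hxa : x = a
      · exact Or.inr hxa.ge
      · exact Or.inl (AddSubmonoid.subset_closure (Finset.mem_coe.2
          (Finset.mem_erase.2 ⟨hxa, hx⟩)))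
    | zero => exact Or.inl (zero_mem _)
    | add x y hx' hy' hx hy =>
      rcases hx with hx | hx
      · rcases hy with hy | hy
        · exact Or.inl (add_mem hx hy)
        · exact Or.inr (hy.trans (le_add_of_nonneg_left (hS x (hA.1 ▸ hx'))))
      · exact Or.inr (hx.trans (le_add_of_nonneg_right (hS y (hA.1 ▸ hy'))))
  rcases key s hs with h1 | h1
  · rcases key t ht with h2 | h2
    · exfalso
      refine hA.2 (A.erase a) (Finset.erase_ssubset hst) (le_antisymm ?_ ?_)
      · rw [← hA.1]
        exact AddSubmonoid.closure_mono (by simp)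
      · rw [← hA.1, AddSubmonoid.closure_le]
        intro x hx
        by_cases hxa : x = a
        · rw [hxa]
          exact add_mem h1 h2
        · exact AddSubmonoid.subset_closure (Finset.mem_coe.2 (Finset.mem_erase.2 ⟨hxa, hx⟩))
    · exact Or.inl (le_antisymm (by simpa [ha] using h2) (hS s hs))
  · exact Or.inr (le_antisymm (by simpa [ha] using h1) (hS t ht))

theorem IsMinGen.le (hS : ∀ s ∈ S, 0 ≤ s) (hA : IsMinGen A S) (hB : IsMinGen B S) : A ⊆ B := by
  intro a ha
  have key : ∀ x ∈ S, x = 0 ∨ x ∈ B ∨ ∃ s ∈ S, ∃ t ∈ S, s ≠ 0 ∧ t ≠ 0 ∧ s + t = x := by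
    intro x hx
    rw [← hB.1] at hx
    induction hx using AddSubmonoid.closure_induction with
    | mem x hx => exact Or.inr (Or.inl hx)
    | zero => exact Or.inl rfl
    | add x y hx' hy' hx hy =>
      by_cases hx0 : x = 0
      · simpa [hx0] using hy
      by_cases hy0 : y = 0
      · simpa [hy0] using hx
      exact Or.inr (Or.inr ⟨x, hB.1 ▸ hx', y, hB.1 ▸ hy', hx0, hy0, rfl⟩)
  rcases key a (hA.mem ha) with h | h | ⟨s, hs, t, ht, hs0, ht0, hst⟩
  · exact absurd (h ▸ ha) hA.zero_notMem
  · exact h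
  · exact ((hA.eq_zero_or_eq_zero_of_add_mem hS hs ht (hst.symm ▸ ha)).elim hs0 ht0).elim

theorem IsMinGen.unique (hS : ∀ s ∈ S, 0 ≤ s) (hA : IsMinGen A S) (hB : IsMinGen B S) : A = B :=
  (hA.le hS hB).antisymm (hB.le hS hA)

theorem relintCone_eq (hS : ∀ s ∈ S, 0 ≤ s) (hA : IsMinGen A S) :
    relintCone S = relintConeOf A := by
  ext x
  exact ⟨fun ⟨B, hB, hx⟩ => hB.unique hS hA ▸ hx, fun hx => ⟨A, hA, hx⟩⟩

end MinimalGenerators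

section Frobenius

variable {m : ℕ} {A A₁ A₂ : Finset (Fin m → ℤ)}

theorem toRat_add (v w : Fin m → ℤ) : toRat (v + w) = toRat v + toRat w := by
  ext i; simp [toRat]

theorem toRat_zsmul (k : ℤ) (v : Fin m → ℤ) : toRat (k • v) = (k : ℚ) • toRat v := by
  ext i; simp [toRat]

theorem toRat_sum {ι : Type*} (s : Finset ι) (f : ι → Fin m → ℤ) :
    toRat (∑ i ∈ s, f i) = ∑ i ∈ s, toRat (f i) := by
  ext i; simp [toRat]

theorem toRat_sum_zsmul (s : Finset (Fin m → ℤ)) (n : (Fin m → ℤ) → ℤ) :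
    toRat (∑ a ∈ s, n a • a) = ∑ a ∈ s, (n a : ℚ) • toRat a := by
  simp_rw [toRat_sum, toRat_zsmul]

theorem toRat_injective : Function.Injective (toRat (m := m)) := by
  intro v w h
  ext i
  have := congrFun h i
  simpa [toRat] using this

theorem mem_groupSpan_closure {x : Fin m → ℤ} :
    x ∈ groupSpan (AddSubmonoid.closure (A : Set (Fin m → ℤ))) ↔
      ∃ n : (Fin m → ℤ) → ℤ, x = ∑ a ∈ A, n a • a := by
  have hspan : groupSpan (AddSubmonoid.closure (A : Set (Fin m → ℤ))) =
      (Submodule.span ℤ (A : Set (Fin m → ℤ))).toAddSubgroup := by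
    rw [groupSpan, Submodule.span_int_eq_addSubgroupClosure]
    refine le_antisymm ((AddSubgroup.closure_le _).2 ?_)
      (AddSubgroup.closure_mono AddSubmonoid.subset_closure)
    exact (AddSubmonoid.closure_le (S := (AddSubgroup.closure
      (A : Set (Fin m → ℤ))).toAddSubmonoid)).2 AddSubgroup.subset_closure
  rw [hspan, Submodule.mem_toAddSubgroup, Submodule.mem_span_finset]
  constructor
  · rintro ⟨n, -, hn⟩
    exact ⟨n, hn.symm⟩
  · rintro ⟨n, hn⟩
    classical
    refine ⟨fun a => if a ∈ A then n a else 0, ?_, ?_⟩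
    · intro a ha
      by_contra h
      exact ha (if_neg h)
    · rw [hn]
      exact Finset.sum_congr rfl fun a ha => by simp [ha]

theorem exists_common_denominator {ι : Type*} (s : Finset ι) (q : ι → ℚ) :
    ∃ N : ℤ, N ≠ 0 ∧ ∃ k : ι → ℤ, ∀ a ∈ s, (k a : ℚ) = N * q a := by
  classical
  obtain ⟨N, hN⟩ := IsLocalization.exist_integer_multiples_of_finset
    (nonZeroDivisors ℤ) (s.image q)
  choose! k hk using hN
  refine ⟨N, nonZeroDivisors.coe_ne_zero N, fun a => k (q a), fun a ha => ?_⟩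
  simpa [Submonoid.smul_def] using hk (q a) (Finset.mem_image_of_mem q ha)

theorem toRat_sum_smul_eq {N : ℤ} {k : (Fin m → ℤ) → ℤ} {q : (Fin m → ℤ) → ℚ}
    (hk : ∀ a ∈ A, (k a : ℚ) = N * q a) :
    toRat (∑ a ∈ A, k a • a) = (N : ℚ) • ∑ a ∈ A, q a • toRat a := by
  rw [toRat_sum_zsmul, Finset.smul_sum]
  exact Finset.sum_congr rfl fun a ha => by rw [hk a ha, mul_smul]

/-- A linearly independent set of generators: `-∑ a` is a Frobenius vector of the free
semigroup. -/
theorem isFrobeniusVector_of_linearIndependent {S : AddSubmonoid (Fin m → ℤ)}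
    (hS : ∀ s ∈ S, 0 ≤ s) (hA : IsMinGen A S) (hne : A.Nonempty)
    (hli : LinearIndependent ℤ (fun a : A => (a : Fin m → ℤ))) :
    IsFrobeniusVector S (-∑ a ∈ A, a) := by
  have hinj : ∀ n : (Fin m → ℤ) → ℤ, ∑ a ∈ A, n a • a = 0 → ∀ a ∈ A, n a = 0 := by
    intro n hn a ha
    have := Fintype.linearIndependent_iff.1 hli (fun a => n a)
      (by rw [← hn]; exact Finset.sum_coe_sort A fun a => n a • a) ⟨a, ha⟩
    exact this
  have hratinj : ∀ q : (Fin m → ℤ) → ℚ, ∑ a ∈ A, q a • toRat a = 0 → ∀ a ∈ A, q a = 0 := by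
    intro q hq a ha
    obtain ⟨N, hN, k, hk⟩ := exists_common_denominator A q
    have h0 := hinj k (toRat_injective (by
      rw [toRat_sum_smul_eq hk, hq, smul_zero]
      ext i; simp [toRat])) a ha
    have := hk a ha
    rw [h0, Int.cast_zero] at this
    exact (mul_eq_zero.1 this.symm).resolve_left (by exact_mod_cast hN)
  have hS' : S = AddSubmonoid.closure (A : Set (Fin m → ℤ)) := hA.1.symm
  have hneg : (-∑ a ∈ A, a) = ∑ a ∈ A, (-1 : ℤ) • a := by
    rw [← Finset.sum_neg_distrib]
    exact Finset.sum_congr rfl fun a _ => (neg_one_zsmul a).symm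
  refine ⟨?_, ?_, ?_⟩
  · rw [hS', mem_groupSpan_closure]
    exact ⟨fun _ => -1, hneg⟩
  · rw [hS', AddSubmonoid.mem_closure_finset]
    rintro ⟨n, -, hn⟩
    obtain ⟨a, ha⟩ := hne
    have := hinj (fun a => n a + 1) (by
      have h : ∀ a ∈ A, ((n a : ℤ) + 1) • a = n a • a + a := fun a _ => by
        rw [add_smul, one_smul, natCast_zsmul]
      rw [Finset.sum_congr rfl h, Finset.sum_add_distrib, hn, neg_add_cancel]) a ha
    omega
  · intro x hx hxr
    rw [relintCone_eq hS hA] at hxr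
    obtain ⟨q, hq, hxq⟩ := hxr
    rw [hS', mem_groupSpan_closure] at hx
    obtain ⟨n, rfl⟩ := hx
    have hnq : ∀ a ∈ A, q a = n a := by
      intro a ha
      have := hratinj (fun a => q a - n a) (by
        simp only [sub_smul, Finset.sum_sub_distrib]
        rw [← hxq, toRat_sum_zsmul, sub_self]) a ha
      linarith
    have : -∑ a ∈ A, a + ∑ a ∈ A, n a • a = ∑ a ∈ A, (n a - 1) • a := by
      rw [hneg, ← Finset.sum_add_distrib]
      exact Finset.sum_congr rfl fun a _ => by rw [← add_smul]; congr 1; ring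
    rw [this]
    refine sum_mem fun a ha => ?_
    have h1 : 0 < n a := by
      have := hq a ha
      rw [hnq a ha] at this
      exact_mod_cast this
    obtain ⟨k, hk⟩ := Int.eq_ofNat_of_zero_le (show 0 ≤ n a - 1 by omega)
    rw [hk, natCast_zsmul]
    exact AddSubmonoid.nsmul_mem _ (hA.mem ha) k

/-- A positive combination of generators stays in the relative interior after adding a nonnegative
multiple of an element of the semigroup. -/
theorem relintConeOf_add_smul {x : Fin m → ℚ} (hx : x ∈ relintConeOf A) {d : Fin m → ℤ}
    (hd : d ∈ AddSubmonoid.closure (A : Set (Fin m → ℤ))) {μ : ℚ} (hμ : 0 ≤ μ) :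
    x + μ • toRat d ∈ relintConeOf A := by
  obtain ⟨q, hq, rfl⟩ := hx
  obtain ⟨e, -, rfl⟩ := AddSubmonoid.mem_closure_finset.1 hd
  refine ⟨fun a => q a + μ * e a, fun a ha => ?_, ?_⟩
  · have := hq a ha
    positivity
  · rw [toRat_sum, Finset.smul_sum, ← Finset.sum_add_distrib]
    refine Finset.sum_congr rfl fun a _ => ?_
    rw [← natCast_zsmul, toRat_zsmul, add_smul, mul_smul]
    simp only [Int.cast_natCast]

/-- The rational version of `G(S₁) ∩ G(S₂) = dℤ`: rational combinations of `A₁` that are also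
rational combinations of `A₂` are rational multiples of `d`. -/
theorem exists_smul_eq_of_rat_combination {d : Fin m → ℤ}
    (hd : groupSpan (AddSubmonoid.closure (A₁ : Set (Fin m → ℤ))) ⊓
      groupSpan (AddSubmonoid.closure (A₂ : Set (Fin m → ℤ))) = AddSubgroup.zmultiples d)
    {q : (Fin m → ℤ) → ℚ}
    (h : ∑ a ∈ A₁, q a • toRat a + ∑ a ∈ A₂, q a • toRat a = 0) :
    ∃ c : ℚ, ∑ a ∈ A₁, q a • toRat a = c • toRat d := by
  classical
  obtain ⟨N, hN, k, hk⟩ := exists_common_denominator (A₁ ∪ A₂) q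
  have hN0 : (N : ℚ) ≠ 0 := by exact_mod_cast hN
  have h₁ := toRat_sum_smul_eq (A := A₁) fun a ha => hk a (Finset.mem_union_left _ ha)
  have h₂ := toRat_sum_smul_eq (A := A₂) fun a ha => hk a (Finset.mem_union_right _ ha)
  have h₁₂ : ∑ a ∈ A₁, k a • a = -∑ a ∈ A₂, k a • a := by
    refine eq_neg_of_add_eq_zero_left (toRat_injective ?_)
    rw [toRat_add, h₁, h₂, ← smul_add, h, smul_zero]
    ext i; simp [toRat]
  have hmem : ∑ a ∈ A₁, k a • a ∈ AddSubgroup.zmultiples d := by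
    rw [← hd]
    exact ⟨mem_groupSpan_closure.2 ⟨_, rfl⟩,
      h₁₂ ▸ (groupSpan _).neg_mem (mem_groupSpan_closure.2 ⟨_, rfl⟩)⟩
  obtain ⟨l, hl⟩ := AddSubgroup.mem_zmultiples_iff.1 hmem
  refine ⟨(l : ℚ) / N, ?_⟩
  have h3 : (N : ℚ) • ∑ a ∈ A₁, q a • toRat a = (l : ℚ) • toRat d := by
    rw [← h₁, ← hl, toRat_zsmul]
  rw [div_eq_inv_mul, mul_smul, ← h3, smul_smul, inv_mul_cancel₀ hN0, one_smul]

/-- If `f₁` and `f₂` are Frobenius vectors of `S₁` and `S₂`, then `f₁ + f₂ + d` is one of the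
gluing `S₁ +_d S₂`. -/
theorem isFrobeniusVector_of_gluing {S : AddSubmonoid (Fin m → ℤ)} (hS : ∀ s ∈ S, 0 ≤ s)
    (hA : IsMinGen (A₁ ∪ A₂) S) (hdisj : Disjoint A₁ A₂) {d f₁ f₂ : Fin m → ℤ}
    (hd₁ : d ∈ AddSubmonoid.closure (A₁ : Set (Fin m → ℤ)))
    (hd₂ : d ∈ AddSubmonoid.closure (A₂ : Set (Fin m → ℤ)))
    (hd : groupSpan (AddSubmonoid.closure (A₁ : Set (Fin m → ℤ))) ⊓
      groupSpan (AddSubmonoid.closure (A₂ : Set (Fin m → ℤ))) = AddSubgroup.zmultiples d)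
    (hf₁ : IsFrobeniusVector (AddSubmonoid.closure (A₁ : Set (Fin m → ℤ))) f₁)
    (hf₂ : IsFrobeniusVector (AddSubmonoid.closure (A₂ : Set (Fin m → ℤ))) f₂) :
    IsFrobeniusVector S (f₁ + f₂ + d) := by
  have hA₁ := hA.subset (Finset.subset_union_left (s₁ := A₁) (s₂ := A₂))
  have hA₂ := hA.subset (Finset.subset_union_right (s₁ := A₁) (s₂ := A₂))
  have hnn : ∀ a ∈ A₁ ∪ A₂, 0 ≤ a := fun a ha => hS a (hA.mem ha)
  have hrel₁ := relintCone_eq (fun s hs => nonneg_of_mem_closure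
    (fun a ha => hnn a (Finset.mem_union_left _ ha)) hs) hA₁
  have hrel₂ := relintCone_eq (fun s hs => nonneg_of_mem_closure
    (fun a ha => hnn a (Finset.mem_union_right _ ha)) hs) hA₂
  have hSsup : S = AddSubmonoid.closure (A₁ : Set (Fin m → ℤ)) ⊔
      AddSubmonoid.closure (A₂ : Set (Fin m → ℤ)) := by
    rw [← hA.1, Finset.coe_union, AddSubmonoid.closure_union]
  have hle₁ : AddSubmonoid.closure (A₁ : Set (Fin m → ℤ)) ≤ S := hSsup ▸ le_sup_left
  have hle₂ : AddSubmonoid.closure (A₂ : Set (Fin m → ℤ)) ≤ S := hSsup ▸ le_sup_right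
  have hG₁ := AddSubgroup.closure_mono (show (_ : Set (Fin m → ℤ)) ⊆ _ from hle₁)
  have hG₂ := AddSubgroup.closure_mono (show (_ : Set (Fin m → ℤ)) ⊆ _ from hle₂)
  refine ⟨?_, ?_, ?_⟩
  · exact add_mem (add_mem (hG₁ hf₁.1) (hG₂ hf₂.1))
      (AddSubgroup.subset_closure (hle₁ hd₁))
  · rw [hSsup]
    intro hf
    obtain ⟨s₁, hs₁, s₂, hs₂, hs⟩ := AddSubmonoid.mem_sup.1 hf
    have hmem : f₁ + d - s₁ ∈ AddSubgroup.zmultiples d := by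
      rw [← hd]
      refine ⟨(groupSpan _).sub_mem (add_mem hf₁.1 (AddSubgroup.subset_closure hd₁))
        (AddSubgroup.subset_closure hs₁), ?_⟩
      have : f₁ + d - s₁ = s₂ - f₂ := by
        rw [sub_eq_sub_iff_add_eq_add, add_comm s₂, hs]; abel
      rw [this]
      exact (groupSpan _).sub_mem (AddSubgroup.subset_closure hs₂) hf₂.1
    obtain ⟨k, hk⟩ := AddSubgroup.mem_zmultiples_iff.1 hmem
    rcases le_or_gt k 0 with hk0 | hk0
    · -- `f₂ = s₂ - k d` lies in `S₂`.
      obtain ⟨l, hl⟩ := Int.eq_ofNat_of_zero_le (show 0 ≤ -k by omega)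
      apply hf₂.2.1
      have : f₂ = s₂ + l • d := by
        rw [← natCast_zsmul, ← hl, neg_smul, hk]
        have : s₂ = f₁ + f₂ + d - s₁ := by rw [← hs]; abel
        rw [this]; abel
      rw [this]
      exact add_mem hs₂ (nsmul_mem hd₂ l)
    · -- `f₁ = s₁ + (k - 1) d` lies in `S₁`.
      obtain ⟨l, hl⟩ := Int.eq_ofNat_of_zero_le (show 0 ≤ k - 1 by omega)
      apply hf₁.2.1
      have : f₁ = s₁ + l • d := by
        rw [← natCast_zsmul, ← hl, sub_smul, hk, one_smul]
        abel
      rw [this]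
      exact add_mem hs₁ (nsmul_mem hd₁ l)
  · intro x hx hxr
    rw [relintCone_eq hS hA] at hxr
    obtain ⟨q, hq, hxq⟩ := hxr
    rw [← hA.1, mem_groupSpan_closure] at hx
    obtain ⟨n, hn⟩ := hx
    rw [Finset.sum_union hdisj] at hxq hn
    set x₁ := ∑ a ∈ A₁, q a • toRat a with hx₁
    set x₂ := ∑ a ∈ A₂, q a • toRat a with hx₂
    set g₁ := ∑ a ∈ A₁, n a • a with hg₁
    set g₂ := ∑ a ∈ A₂, n a • a with hg₂
    have hr₁ : ∑ a ∈ A₁, ((n a : ℚ) - q a) • toRat a = toRat g₁ - x₁ := by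
      simp only [sub_smul, Finset.sum_sub_distrib, hg₁, hx₁, toRat_sum_zsmul]
    have hr₂ : ∑ a ∈ A₂, ((n a : ℚ) - q a) • toRat a = toRat g₂ - x₂ := by
      simp only [sub_smul, Finset.sum_sub_distrib, hg₂, hx₂, toRat_sum_zsmul]
    have heq : toRat g₁ - x₁ + (toRat g₂ - x₂) = 0 := by
      rw [sub_add_sub_comm, ← toRat_add, ← hn, hxq, sub_self]
    obtain ⟨c, hc⟩ := exists_smul_eq_of_rat_combination hd (q := fun a => (n a : ℚ) - q a)
      (by rw [hr₁, hr₂, heq])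
    rw [hr₁] at hc
    -- Moving the integral part of `c` from one side to the other leaves both components in the
    -- relative interiors of their cones.
    have hz₁ : toRat (g₁ + (-⌊c⌋) • d) = x₁ + (c - ⌊c⌋) • toRat d := by
      rw [toRat_add, toRat_zsmul, sub_smul, ← hc]
      push_cast
      rw [neg_smul]; abel
    have hz₂ : toRat (g₂ + (⌊c⌋ + 1) • d) = x₂ + (⌊c⌋ + 1 - c) • toRat d := by
      rw [toRat_add, toRat_zsmul, sub_smul, ← hc, eq_neg_of_add_eq_zero_left heq]
      push_cast
      abel
    have hmem₁ := hf₁.2.2 (g₁ + (-⌊c⌋) • d)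
      (add_mem (mem_groupSpan_closure.2 ⟨n, rfl⟩)
        (zsmul_mem (AddSubgroup.subset_closure hd₁) _))
      (by
        rw [hrel₁, hz₁]
        exact relintConeOf_add_smul ⟨q, fun a ha => hq a (Finset.mem_union_left _ ha), rfl⟩ hd₁
          (sub_nonneg.2 (Int.floor_le c)))
    have hmem₂ := hf₂.2.2 (g₂ + (⌊c⌋ + 1) • d)
      (add_mem (mem_groupSpan_closure.2 ⟨n, rfl⟩)
        (zsmul_mem (AddSubgroup.subset_closure hd₂) _))
      (by
        rw [hrel₂, hz₂]
        exact relintConeOf_add_smul ⟨q, fun a ha => hq a (Finset.mem_union_right _ ha), rfl⟩ hd₂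
          (sub_nonneg.2 (Int.lt_floor_add_one c).le))
    have := add_mem (hle₁ hmem₁) (hle₂ hmem₂)
    convert this using 1
    rw [hn, add_smul, neg_smul, one_smul]
    abel

end Frobenius

/-- For every decomposition of a nonzero semigroup of nonnegative vectors into free semigroups by
gluings, the sum of the gluing vectors minus the sum of the generators is a Frobenius vector. -/
theorem IsFreeGluing.isFrobeniusVector {m : ℕ} {S : AddSubmonoid (Fin m → ℤ)}
    {P : List (Finset (Fin m → ℤ))} {D : List (Fin m → ℤ)} (h : IsFreeGluing S P D)
    (hS : ∀ s ∈ S, 0 ≤ s) {A : Finset (Fin m → ℤ)} (hA : IsMinGen A S) (hne : A.Nonempty) :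
    IsFrobeniusVector S (D.sum - ∑ a ∈ A, a) := by
  induction h generalizing A with
  | free S B hB hli =>
    obtain rfl := hA.unique hS hB
    simpa using isFrobeniusVector_of_linearIndependent hS hA hne hli
  | glue S S₁ S₂ d P₁ P₂ D₁ D₂ h h₁ h₂ ih₁ ih₂ =>
    obtain ⟨⟨A₁, A₂, hA', hdisj, hne₁, hne₂, rfl, rfl⟩, hd₁, hd₂, hd⟩ := h
    obtain rfl := hA.unique hS hA'
    have hnn : ∀ a ∈ A₁ ∪ A₂, 0 ≤ a := fun a ha => hS a (hA.mem ha)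
    have hF₁ := ih₁ (fun s hs => nonneg_of_mem_closure
      (fun a ha => hnn a (Finset.mem_union_left _ ha)) hs) (hA.subset Finset.subset_union_left) hne₁
    have hF₂ := ih₂ (fun s hs => nonneg_of_mem_closure
      (fun a ha => hnn a (Finset.mem_union_right _ ha)) hs)
      (hA.subset Finset.subset_union_right) hne₂
    have := isFrobeniusVector_of_gluing hS hA hdisj hd₁ hd₂ hd hF₁ hF₂
    convert this using 1
    rw [Finset.sum_union hdisj, List.sum_append, List.sum_cons]
    abel

/-! ### Toric ideals and Krull's height theorem -/

section ToricIdeal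

open MvPolynomial

variable {σ : Type*} [Fintype σ]

/-- The monomial with exponent vector `u`. -/
noncomputable def mon (u : σ → ℕ) : MvPolynomial σ ℚ := ∏ a, X a ^ u a

/-- The exponent vector `u` as a rational vector. -/
def ratVec (u : σ → ℕ) : σ → ℚ := fun a => (u a : ℚ)

open scoped Classical in
/-- The homomorphism of `ℚ[x]` to the algebra of the torsion-free group `ℚ^σ / U` that grades the
variable `x_a` by the class of the standard basis vector of `a`. -/
noncomputable def toricHom (U : Submodule ℚ (σ → ℚ)) :
    MvPolynomial σ ℚ →ₐ[ℚ] AddMonoidAlgebra ℚ ((σ → ℚ) ⧸ U) :=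
  aeval fun a => AddMonoidAlgebra.single (U.mkQ (Pi.single a 1)) 1

/-- The toric ideal of the saturated lattice `U ∩ ℤ^σ`. -/
noncomputable def toricIdeal (U : Submodule ℚ (σ → ℚ)) : Ideal (MvPolynomial σ ℚ) :=
  RingHom.ker (toricHom U)

instance toricIdeal_isPrime (U : Submodule ℚ (σ → ℚ)) : (toricIdeal U).IsPrime :=
  RingHom.ker_isPrime _

theorem mon_add (u v : σ → ℕ) : mon (u + v) = mon u * mon v := by
  simp [mon, pow_add, Finset.prod_mul_distrib]

theorem monomial_one_eq_mon (s : σ →₀ ℕ) : monomial s (1 : ℚ) = mon s := by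
  rw [MvPolynomial.monomial_eq, C_1, one_mul, mon, Finsupp.prod_fintype]
  simp

theorem toricHom_mon (U : Submodule ℚ (σ → ℚ)) (u : σ → ℕ) :
    toricHom U (mon u) = AddMonoidAlgebra.single (U.mkQ (ratVec u)) 1 := by
  classical
  have h1 : ∀ (s : Finset σ) (f : σ → (σ → ℚ) ⧸ U),
      ∏ a ∈ s, AddMonoidAlgebra.single (f a) (1 : ℚ) =
        AddMonoidAlgebra.single (∑ a ∈ s, f a) 1 := by
    intro s f
    induction s using Finset.induction_on with
    | empty => simp [AddMonoidAlgebra.one_def]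
    | insert a s ha ih => rw [Finset.prod_insert ha, Finset.sum_insert ha, ih,
        AddMonoidAlgebra.single_mul_single, mul_one]
  have h2 : ratVec u = ∑ a, u a • (Pi.single a 1 : σ → ℚ) := by
    ext b
    simp [ratVec, Finset.sum_apply, Pi.single_apply]
  simp only [mon, map_prod, map_pow, toricHom, aeval_X, AddMonoidAlgebra.single_pow, one_pow]
  rw [h1, h2, map_sum]
  simp only [map_nsmul]

theorem mon_sub_mon_mem_toricIdeal (U : Submodule ℚ (σ → ℚ)) (u v : σ → ℕ) :
    mon u - mon v ∈ toricIdeal U ↔ ratVec u - ratVec v ∈ U := by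
  rw [toricIdeal, RingHom.mem_ker, map_sub, toricHom_mon, toricHom_mon, sub_eq_zero,
    AddMonoidAlgebra.single_left_inj one_ne_zero, ← sub_eq_zero, ← map_sub,
    Submodule.mkQ_apply, Submodule.Quotient.mk_eq_zero]

theorem X_notMem_toricIdeal {τ : Type*} (U : Submodule ℚ (τ → ℚ)) (a : τ) : X a ∉ toricIdeal U := by
  rw [toricIdeal, RingHom.mem_ker, toricHom, aeval_X]
  simp

/-- A toric ideal is spanned by its binomials: collecting the terms of each degree, any polynomial
is modulo binomials a combination of one chosen monomial per degree. -/
theorem toricIdeal_le {U : Submodule ℚ (σ → ℚ)} {J : Ideal (MvPolynomial σ ℚ)}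
    (h : ∀ u v : σ → ℕ, ratVec u - ratVec v ∈ U → mon u - mon v ∈ J) : toricIdeal U ≤ J := by
  classical
  intro f hf
  have hr : ∀ g : (σ → ℚ) ⧸ U, ∃ w : σ → ℕ, ∀ u : σ → ℕ, U.mkQ (ratVec u) = g →
      U.mkQ (ratVec w) = g := by
    intro g
    by_cases hg : ∃ u : σ → ℕ, U.mkQ (ratVec u) = g
    · exact ⟨hg.choose, fun _ _ => hg.choose_spec⟩
    · exact ⟨0, fun u hu => absurd ⟨u, hu⟩ hg⟩
  choose r hr using hr
  let T : AddMonoidAlgebra ℚ ((σ → ℚ) ⧸ U) →ₗ[ℚ] MvPolynomial σ ℚ :=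
    (Finsupp.linearCombination ℚ fun g => mon (r g)) ∘ₗ
      (AddMonoidAlgebra.coeffLinearEquiv ℚ).toLinearMap
  have hT : ∀ u : σ → ℕ, T (toricHom U (mon u)) = mon (r (U.mkQ (ratVec u))) := by
    intro u
    rw [toricHom_mon]
    change Finsupp.linearCombination ℚ (fun g => mon (r g))
      (AddMonoidAlgebra.single _ (1 : ℚ)).coeff = _
    rw [AddMonoidAlgebra.coeff_single, Finsupp.linearCombination_single, one_smul]
  have key : ∀ p : MvPolynomial σ ℚ, p - T (toricHom U p) ∈ J := by
    intro p
    induction p using MvPolynomial.induction_on' with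
    | monomial s c =>
      have hs : monomial s c = c • mon s := by
        rw [← monomial_one_eq_mon, smul_monomial, smul_eq_mul, mul_one]
      rw [hs, map_smul, map_smul, hT, ← smul_sub, smul_eq_C_mul]
      refine J.mul_mem_left _ (h _ _ ?_)
      rw [← Submodule.Quotient.mk_eq_zero, ← Submodule.mkQ_apply, map_sub, sub_eq_zero]
      exact (hr _ s rfl).symm
    | add p q hp hq =>
      rw [map_add, map_add, add_sub_add_comm]
      exact J.add_mem hp hq
  have := key f
  rwa [show toricHom U f = 0 from hf, map_zero, sub_zero] at this

theorem toricIdeal_lt_of_lt {U U' : Submodule ℚ (σ → ℚ)} (h : U < U') :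
    toricIdeal U < toricIdeal U' := by
  refine lt_of_le_of_ne (toricIdeal_le fun u v huv =>
    (mon_sub_mon_mem_toricIdeal U' u v).2 (h.le huv)) fun heq => ?_
  obtain ⟨x, hx', hx⟩ := SetLike.exists_of_lt h
  obtain ⟨N, hN, k, hk⟩ := exists_common_denominator Finset.univ x
  have hN' : (N : ℚ) ≠ 0 := by exact_mod_cast hN
  -- A multiple of `x` is a difference of two exponent vectors.
  have hx2 : ratVec (fun a => (k a).toNat) - ratVec (fun a => (-k a).toNat) = (N : ℚ) • x := by
    ext a
    rw [Pi.smul_apply, smul_eq_mul, ← hk a (Finset.mem_univ a)]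
    simp only [Pi.sub_apply, ratVec]
    exact_mod_cast Int.toNat_sub_toNat_neg (k a)
  have h1 := (mon_sub_mon_mem_toricIdeal U' _ _).2 (hx2 ▸ U'.smul_mem (N : ℚ) hx')
  rw [← heq, mon_sub_mon_mem_toricIdeal, hx2, U.smul_mem_iff hN'] at h1
  exact hx h1

/-- The toric ideal of a lattice of rank `n` has height at least `n`: a complete flag of rational
subspaces gives a chain of toric ideals. -/
theorem le_height_toricIdeal (n : ℕ) (U : Submodule ℚ (σ → ℚ)) (hU : Module.finrank ℚ U = n) :
    (n : ℕ∞) ≤ (toricIdeal U).height := by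
  induction n generalizing U with
  | zero => simp
  | succ n ih =>
    let b := Module.finBasisOfFinrankEq ℚ U hU
    have hli : LinearIndependent ℚ fun i : Fin n => (b i.castSucc : σ → ℚ) :=
      (b.linearIndependent.comp _ (Fin.castSucc_injective n)).map' U.subtype U.ker_subtype
    set U' := Submodule.span ℚ (Set.range fun i : Fin n => (b i.castSucc : σ → ℚ)) with hU'
    have hfin : Module.finrank ℚ U' = n := by
      rw [hU', finrank_span_eq_card hli, Fintype.card_fin]
    have hle : U' ≤ U := by
      rw [hU', Submodule.span_le]
      rintro _ ⟨i, rfl⟩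
      exact (b i.castSucc).2
    have hlt : U' < U := lt_of_le_of_ne hle fun h => by rw [h, hU] at hfin; omega
    calc ((n + 1 : ℕ) : ℕ∞) = n + 1 := by push_cast; rfl
      _ ≤ (toricIdeal U').height + 1 := by gcongr; exact ih U' hfin
      _ ≤ (toricIdeal U).height :=
        Ideal.height_add_one_le_of_lt_of_isPrime (toricIdeal_lt_of_lt hlt)

open scoped Classical in
/-- The binomials of a presentation with as few relations as the rank of the relation lattice form
a dominating system: if at least `|C|` of them vanish on the coordinate subspace `x_C = 0`, then
the variables in `C` together with the remaining binomials generate an ideal of height at most that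
rank. A minimal prime over it contains the toric ideal properly, against Krull's height theorem. -/
theorem card_filter_lt_card (U : Submodule ℚ (σ → ℚ)) (ρ : Finset ((σ → ℕ) × (σ → ℕ)))
    (hcard : Module.finrank ℚ U = ρ.card)
    (hgen : ∀ u v : σ → ℕ, ratVec u - ratVec v ∈ U → addConGen (fun x y => (x, y) ∈ ρ) u v)
    (hpos : ∀ p ∈ ρ, p.1 = 0 ↔ p.2 = 0) (C : Finset σ) (hC : C.Nonempty) :
    (ρ.filter fun p => (∃ a ∈ C, p.1 a ≠ 0) ∧ ∃ a ∈ C, p.2 a ≠ 0).card < C.card := by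
  by_contra hlt
  push Not at hlt
  set M : (σ → ℕ) × (σ → ℕ) → Prop := fun p => (∃ a ∈ C, p.1 a ≠ 0) ∧ ∃ a ∈ C, p.2 a ≠ 0
  set f : (σ → ℕ) × (σ → ℕ) → MvPolynomial σ ℚ := fun p => mon p.1 - mon p.2
  set G : Finset (MvPolynomial σ ℚ) := C.image X ∪ (ρ.filter (¬ M ·)).image f
  have hGcard : G.card ≤ ρ.card := by
    have h1 : G.card ≤ C.card + (ρ.filter (¬ M ·)).card :=
      (Finset.card_union_le _ _).trans (add_le_add Finset.card_image_le Finset.card_image_le)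
    have h2 : C.card ≤ (ρ.filter M).card := hlt
    have h3 := Finset.card_filter_add_card_filter_not (s := ρ) M
    omega
  have hmon0 : ∀ u : σ → ℕ, constantCoeff (mon u) = if u = 0 then (1 : ℚ) else 0 := by
    intro u
    rw [mon, map_prod]
    split_ifs with hu
    · simp [hu]
    · obtain ⟨a, ha⟩ := Function.ne_iff.1 hu
      refine Finset.prod_eq_zero (Finset.mem_univ a) ?_
      rw [map_pow, constantCoeff_X, zero_pow ha]
  have hGle : Ideal.span (G : Set (MvPolynomial σ ℚ)) ≤ RingHom.ker constantCoeff := by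
    rw [Ideal.span_le]
    intro g hg
    rcases Finset.mem_union.1 hg with hg | hg
    · obtain ⟨a, -, rfl⟩ := Finset.mem_image.1 hg
      exact MvPolynomial.constantCoeff_X _ a
    · obtain ⟨p, hp, rfl⟩ := Finset.mem_image.1 hg
      have := hpos p (Finset.mem_filter.1 hp).1
      change constantCoeff (mon p.1 - mon p.2) = 0
      simp [hmon0, this]
  have hker : (RingHom.ker (constantCoeff (σ := σ) (R := ℚ))).IsPrime := RingHom.ker_isPrime _
  obtain ⟨P, hP, -⟩ := Ideal.exists_minimalPrimes_le hGle
  have hPprime : P.IsPrime := hP.1.1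
  have hPheight : P.height ≤ ρ.card :=
    (Ideal.height_le_card_of_mem_minimalPrimes_span_finset hP).trans (by exact_mod_cast hGcard)
  have hGP : ∀ g ∈ G, g ∈ P := fun g hg => hP.1.2 (Ideal.subset_span hg)
  have hXP : ∀ a ∈ C, X a ∈ P := fun a ha =>
    hGP _ (Finset.mem_union_left _ (Finset.mem_image_of_mem _ ha))
  have hmonP : ∀ u : σ → ℕ, (∃ a ∈ C, u a ≠ 0) → mon u ∈ P := by
    rintro u ⟨a, ha, hua⟩
    exact Ideal.mem_of_dvd P ((dvd_pow_self (X a) hua).trans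
      (Finset.dvd_prod_of_mem (fun a => X a ^ u a) (Finset.mem_univ a))) (hXP a ha)
  have hρP : ∀ p ∈ ρ, mon p.1 - mon p.2 ∈ P := by
    intro p hp
    by_cases hM : M p
    · exact P.sub_mem (hmonP _ hM.1) (hmonP _ hM.2)
    · exact hGP _ (Finset.mem_union_right _
        (Finset.mem_image_of_mem f (Finset.mem_filter.2 ⟨hp, hM⟩)))
  -- The binomials in `P` form a congruence, so `P` contains all binomials of the toric ideal.
  let c : AddCon (σ → ℕ) :=
    { r := fun u v => mon u - mon v ∈ P
      iseqv :=
        { refl := fun u => by simp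
          symm := fun {u v} h => by simpa using P.neg_mem h
          trans := fun {u v w} h h' => by simpa using P.add_mem h h' }
      add' := fun {u v w z} h h' => by
        have : mon (u + w) - mon (v + z) = mon w * (mon u - mon v) + mon v * (mon w - mon z) := by
          rw [mon_add, mon_add]; ring
        rw [this]
        exact P.add_mem (P.mul_mem_left _ h) (P.mul_mem_left _ h') }
  have hc : addConGen (fun x y => (x, y) ∈ ρ) ≤ c :=
    AddCon.addConGen_le.2 fun u v huv => hρP (u, v) huv
  have hle : toricIdeal U ≤ P := toricIdeal_le fun u v huv => hc (hgen u v huv)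
  obtain ⟨a, ha⟩ := hC
  have hlt' : toricIdeal U < P := lt_of_le_of_ne hle fun h =>
    X_notMem_toricIdeal U a (h ▸ hXP a ha)
  have h1 := Ideal.height_add_one_le_of_lt_of_isPrime hlt'
  have h2 := le_height_toricIdeal _ U hcard
  have h3 : ((ρ.card + 1 : ℕ) : ℕ∞) ≤ (ρ.card : ℕ) := by
    push_cast
    exact (add_le_add_left h2 1).trans (h1.trans hPheight)
  have : ρ.card + 1 ≤ ρ.card := by exact_mod_cast h3
  omega

end ToricIdeal

/-! ### Gluings from dominating systems of relations -/

section Decomposition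

variable {m : ℕ}

/-- Nonzero vectors of `ℕ^m` admit no nontrivial relation with nonnegative coefficients. -/
theorem eq_zero_of_sum_zsmul_eq_zero {A : Finset (Fin m → ℤ)} (hA : ∀ a ∈ A, 0 ≤ a)
    (hA0 : (0 : Fin m → ℤ) ∉ A) {n : (Fin m → ℤ) → ℤ} (hn : ∀ a ∈ A, 0 ≤ n a)
    (h : ∑ a ∈ A, n a • a = 0) : ∀ a ∈ A, n a = 0 := by
  intro a ha
  have h1 := (Finset.sum_eq_zero_iff_of_nonneg
    (fun a ha => zsmul_nonneg (hA a ha) (hn a ha))).1 h a ha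
  exact (smul_eq_zero.1 h1).resolve_right (ne_of_mem_of_not_mem ha hA0)

theorem sum_zsmul_mem_closure {A : Finset (Fin m → ℤ)} {n : (Fin m → ℤ) → ℤ}
    (hn : ∀ a ∈ A, 0 ≤ n a) :
    ∑ a ∈ A, n a • a ∈ AddSubmonoid.closure (A : Set (Fin m → ℤ)) := by
  refine sum_mem fun a ha => ?_
  obtain ⟨k, hk⟩ := Int.eq_ofNat_of_zero_le (hn a ha)
  rw [hk, natCast_zsmul]
  exact nsmul_mem (AddSubmonoid.subset_closure ha) k

theorem relation_of_mem_closure {A : Finset (Fin m → ℤ)} {W : Set ((Fin m → ℤ) → ℤ)}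
    {B : Set (Fin m → ℤ)} (hW : ∀ x ∈ W, (∀ a ∈ B, x a = 0) ∧ ∑ a ∈ A, x a • a = 0)
    {r : (Fin m → ℤ) → ℤ} (hr : r ∈ AddSubgroup.closure W) :
    (∀ a ∈ B, r a = 0) ∧ ∑ a ∈ A, r a • a = 0 := by
  induction hr using AddSubgroup.closure_induction with
  | mem x hx => exact hW x hx
  | zero => simp
  | add x y _ _ hx hy =>
    refine ⟨fun a ha => by simp [hx.1 a ha, hy.1 a ha], ?_⟩
    simp_rw [Pi.add_apply, add_smul, Finset.sum_add_distrib, hx.2, hy.2, add_zero]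
  | neg x _ hx =>
    refine ⟨fun a ha => by simp [hx.1 a ha], ?_⟩
    simp_rw [Pi.neg_apply, neg_smul, Finset.sum_neg_distrib, hx.2, neg_zero]

open scoped Classical in
/-- `W` is a set of nonzero relations between the vectors in `A` that generates all relations and
whose sign patterns form a dominating system. A relation is an integral function on all of `ℤ^m`
that vanishes outside `A`. -/
structure IsDominatingRelations (A : Finset (Fin m → ℤ)) (W : Finset ((Fin m → ℤ) → ℤ)) : Prop where
  eq_zero : ∀ w ∈ W, ∀ a, a ∉ A → w a = 0
  sum_eq_zero : ∀ w ∈ W, ∑ a ∈ A, w a • a = 0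
  ne_zero : ∀ w ∈ W, w ≠ 0
  mem_closure : ∀ n : (Fin m → ℤ) → ℤ, (∀ a, a ∉ A → n a = 0) → ∑ a ∈ A, n a • a = 0 →
    n ∈ AddSubgroup.closure (W : Set ((Fin m → ℤ) → ℤ))
  card_lt : ∀ C : Finset (Fin m → ℤ), C.Nonempty →
    (W.filter fun w => (∃ a ∈ C, 0 < w a) ∧ ∃ a ∈ C, w a < 0).card < C.card

open scoped Classical in
/-- The decomposition theorem for dominating systems, in terms of relations: one relation is
nonnegative on one block of generators and nonpositive on the other, and every other relation only
involves one of the blocks. -/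
theorem IsDominatingRelations.exists_block {A : Finset (Fin m → ℤ)}
    {W : Finset ((Fin m → ℤ) → ℤ)} (hW : IsDominatingRelations A W) (hA : ∀ a ∈ A, 0 ≤ a)
    (hA0 : (0 : Fin m → ℤ) ∉ A) (hne : W.Nonempty) :
    ∃ w ∈ W, ∃ C : Set (Fin m → ℤ), (∃ a ∈ A, a ∈ C ∧ 0 < w a) ∧ (∃ a ∈ A, a ∉ C ∧ w a < 0) ∧
      (∀ a ∈ A, a ∈ C → 0 ≤ w a) ∧ (∀ a ∈ A, a ∉ C → w a ≤ 0) ∧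
      ∀ w' ∈ W, w' ≠ w → (∀ a, a ∉ C → w' a = 0) ∨ ∀ a, a ∈ C → w' a = 0 := by
  set sgn : ((Fin m → ℤ) → ℤ) → Finset (Fin m → ℤ) × Finset (Fin m → ℤ) :=
    fun w => (A.filter (0 < w ·), A.filter (w · < 0)) with hsgn
  have hpos : ∀ w ∈ W, ∃ a ∈ A, 0 < w a := by
    intro w hw
    by_contra! h
    refine hW.ne_zero w hw (funext fun a => ?_)
    by_cases ha : a ∈ A
    · have := eq_zero_of_sum_zsmul_eq_zero hA hA0 (n := -w)
        (fun a ha => by simpa using h a ha)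
        (by simp_rw [Pi.neg_apply, neg_smul, Finset.sum_neg_distrib, hW.sum_eq_zero w hw,
              neg_zero]) a ha
      simpa using this
    · exact hW.eq_zero w hw a ha
  have hneg : ∀ w ∈ W, ∃ a ∈ A, w a < 0 := by
    intro w hw
    by_contra! h
    refine hW.ne_zero w hw (funext fun a => ?_)
    by_cases ha : a ∈ A
    · exact eq_zero_of_sum_zsmul_eq_zero hA hA0 h (hW.sum_eq_zero w hw) a ha
    · exact hW.eq_zero w hw a ha
  have hdom : Dominating (W.image sgn) := by
    intro C hC
    refine lt_of_le_of_lt ?_ (hW.card_lt C hC)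
    refine le_trans (Finset.card_le_card ?_) (Finset.card_image_le (f := sgn))
    intro k hk
    obtain ⟨hk, ⟨p, hp, hp'⟩, q, hq, hq'⟩ := Finset.mem_filter.1 hk
    obtain ⟨w, hw, rfl⟩ := Finset.mem_image.1 hk
    exact Finset.mem_image_of_mem _ (Finset.mem_filter.2
      ⟨hw, ⟨p, hp, (Finset.mem_filter.1 hp').2⟩, q, hq, (Finset.mem_filter.1 hq').2⟩)
  -- Two relations with the same sign pattern are both mixed on two columns.
  have hinj : ∀ w ∈ W, ∀ w' ∈ W, sgn w' = sgn w → w' = w := by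
    intro w hw w' hw' h
    by_contra hww
    obtain ⟨p, hpA, hp⟩ := hpos w hw
    obtain ⟨q, hqA, hq⟩ := hneg w hw
    have hp' : p ∈ (sgn w').1 := h ▸ Finset.mem_filter.2 ⟨hpA, hp⟩
    have hq' : q ∈ (sgn w').2 := h ▸ Finset.mem_filter.2 ⟨hqA, hq⟩
    have h1 := hW.card_lt {p, q} (by simp)
    have h2 : ({w', w} : Finset _) ⊆
        W.filter fun w => (∃ a ∈ ({p, q} : Finset _), 0 < w a) ∧
          ∃ a ∈ ({p, q} : Finset _), w a < 0 := by
      intro x hx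
      rcases Finset.mem_insert.1 hx with rfl | hx
      · exact Finset.mem_filter.2 ⟨hw', ⟨p, by simp, (Finset.mem_filter.1 hp').2⟩,
          q, by simp, (Finset.mem_filter.1 hq').2⟩
      · rw [Finset.mem_singleton.1 hx]
        exact Finset.mem_filter.2 ⟨hw, ⟨p, by simp, hp⟩, q, by simp, hq⟩
    have h3 := Finset.card_le_card h2
    rw [Finset.card_pair hww] at h3
    have h4 := Finset.card_le_two (a := p) (b := q)
    omega
  obtain ⟨l, hl, C, hC1, hC2, hC3⟩ := exists_separates (W.image sgn) (hne.image _) (by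
    intro k hk
    obtain ⟨w, hw, rfl⟩ := Finset.mem_image.1 hk
    obtain ⟨p, hpA, hp⟩ := hpos w hw
    obtain ⟨q, hqA, hq⟩ := hneg w hw
    exact ⟨⟨p, Finset.mem_filter.2 ⟨hpA, hp⟩⟩, q, Finset.mem_filter.2 ⟨hqA, hq⟩⟩) hdom
  obtain ⟨w, hw, rfl⟩ := Finset.mem_image.1 hl
  have hvan : ∀ w' ∈ W, ∀ B : Set (Fin m → ℤ), RowIn B (sgn w') → ∀ a, a ∉ B → w' a = 0 := by
    intro w' hw' B hB a ha
    by_cases haA : a ∈ A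
    · by_contra h
      rcases lt_or_gt_of_ne h with h | h
      · exact ha (hB.2 a (Finset.mem_filter.2 ⟨haA, h⟩))
      · exact ha (hB.1 a (Finset.mem_filter.2 ⟨haA, h⟩))
    · exact hW.eq_zero w' hw' a haA
  refine ⟨w, hw, C, ?_, ?_, ?_, ?_, ?_⟩
  · obtain ⟨p, hpA, hp⟩ := hpos w hw
    exact ⟨p, hpA, hC1 p (Finset.mem_filter.2 ⟨hpA, hp⟩), hp⟩
  · obtain ⟨q, hqA, hq⟩ := hneg w hw
    exact ⟨q, hqA, hC2 q (Finset.mem_filter.2 ⟨hqA, hq⟩), hq⟩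
  · intro a ha haC
    by_contra! h
    exact hC2 a (Finset.mem_filter.2 ⟨ha, h⟩) haC
  · intro a ha haC
    by_contra! h
    exact haC (hC1 a (Finset.mem_filter.2 ⟨ha, h⟩))
  · intro w' hw' hww
    rcases hC3 _ (Finset.mem_image_of_mem sgn hw') (fun h => hww (hinj w hw w' hw' h)) with h | h
    · exact Or.inl (hvan w' hw' C h)
    · exact Or.inr fun a ha => hvan w' hw' Cᶜ h a fun h => h ha

open scoped Classical in
/-- A system with a dominating generating set of relations is obtained from free semigroups by
gluings: the separating relation yields the gluing vector, and each block inherits a dominating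
generating set of relations. -/
theorem IsDominatingRelations.exists_isFreeGluing {A : Finset (Fin m → ℤ)}
    {W : Finset ((Fin m → ℤ) → ℤ)} (hW : IsDominatingRelations A W) (hA : ∀ a ∈ A, 0 ≤ a)
    (hmin : IsMinGen A (AddSubmonoid.closure (A : Set (Fin m → ℤ)))) :
    ∃ P D, IsFreeGluing (AddSubmonoid.closure (A : Set (Fin m → ℤ))) P D := by
  induction hcard : W.card using Nat.strong_induction_on generalizing A W with
  | _ N IH =>
  subst hcard
  have hA0 := hmin.zero_notMem
  rcases W.eq_empty_or_nonempty with rfl | hne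
  · refine ⟨[A], [], IsFreeGluing.free _ A hmin (Fintype.linearIndependent_iff.2 ?_)⟩
    intro g hg a
    have := hW.mem_closure (fun x => if h : x ∈ A then g ⟨x, h⟩ else 0)
      (fun x hx => dif_neg hx) (by
        rw [← hg, ← Finset.sum_coe_sort A]
        simp)
    rw [Finset.coe_empty, AddSubgroup.closure_empty, AddSubgroup.mem_bot] at this
    simpa using congrFun this a
  obtain ⟨w, hw, C, ⟨p, hpA, hpC, hp⟩, ⟨q, hqA, hqC, hq⟩, hwC, hwC', hrest⟩ :=
    hW.exists_block hA hA0 hne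
  set A₁ := A.filter (· ∈ C) with hA₁
  set A₂ := A.filter (· ∉ C) with hA₂
  have hunion : A₁ ∪ A₂ = A := Finset.filter_union_filter_not_eq _ A
  have hdisj : Disjoint A₁ A₂ := Finset.disjoint_filter_filter_not _ _ _
  have hsplit : ∀ n : (Fin m → ℤ) → ℤ,
      ∑ a ∈ A₁, n a • a + ∑ a ∈ A₂, n a • a = ∑ a ∈ A, n a • a := fun n => by
    rw [← Finset.sum_union hdisj, hunion]
  set W₁ := (W.erase w).filter (fun w' => ∀ a, a ∉ C → w' a = 0) with hW₁
  set W₂ := (W.erase w).filter (fun w' => ∀ a, a ∈ C → w' a = 0) with hW₂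
  have hW₁W : W₁ ⊆ W := (Finset.filter_subset _ _).trans (Finset.erase_subset _ _)
  have hW₂W : W₂ ⊆ W := (Finset.filter_subset _ _).trans (Finset.erase_subset _ _)
  have hlt : (W.erase w).card < W.card := Finset.card_erase_lt_of_mem hw
  have hlt₁ : W₁.card < W.card := (Finset.card_filter_le _ _).trans_lt hlt
  have hlt₂ : W₂.card < W.card := (Finset.card_filter_le _ _).trans_lt hlt
  have hr₁ : ∀ r ∈ AddSubgroup.closure (W₁ : Set ((Fin m → ℤ) → ℤ)),
      (∀ a, a ∉ C → r a = 0) ∧ ∑ a ∈ A, r a • a = 0 := fun r hr =>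
    relation_of_mem_closure (B := Cᶜ) (fun x hx =>
      ⟨(Finset.mem_filter.1 hx).2, hW.sum_eq_zero x (hW₁W hx)⟩) hr
  have hr₂ : ∀ r ∈ AddSubgroup.closure (W₂ : Set ((Fin m → ℤ) → ℤ)),
      (∀ a, a ∈ C → r a = 0) ∧ ∑ a ∈ A, r a • a = 0 := fun r hr =>
    relation_of_mem_closure (B := C) (fun x hx =>
      ⟨(Finset.mem_filter.1 hx).2, hW.sum_eq_zero x (hW₂W hx)⟩) hr
  have hvan₁ : ∀ r : (Fin m → ℤ) → ℤ, (∀ a, a ∈ C → r a = 0) → ∑ a ∈ A₁, r a • a = 0 :=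
    fun r hr => Finset.sum_eq_zero fun a ha => by rw [hr a (Finset.mem_filter.1 ha).2, zero_smul]
  have hvan₂ : ∀ r : (Fin m → ℤ) → ℤ, (∀ a, a ∉ C → r a = 0) → ∑ a ∈ A₂, r a • a = 0 :=
    fun r hr => Finset.sum_eq_zero fun a ha => by rw [hr a (Finset.mem_filter.1 ha).2, zero_smul]
  set d := ∑ a ∈ A₁, w a • a with hd
  have hd' : d = ∑ a ∈ A₂, (-w a) • a := by
    simp_rw [neg_smul, Finset.sum_neg_distrib]
    exact eq_neg_of_add_eq_zero_left ((hsplit w).trans (hW.sum_eq_zero w hw))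
  have hd0 : d ≠ 0 := by
    intro h
    have := eq_zero_of_sum_zsmul_eq_zero (A := A₁) (fun a ha => hA a (Finset.mem_filter.1 ha).1)
      (fun h => hA0 (Finset.mem_filter.1 h).1)
      (fun a ha => hwC a (Finset.mem_filter.1 ha).1 (Finset.mem_filter.1 ha).2) h p
      (Finset.mem_filter.2 ⟨hpA, hpC⟩)
    exact hp.ne' this
  -- A relation is a multiple of `w` plus relations inside the two blocks, so that its value on the
  -- first block is a multiple of `d`.
  have hdec : ∀ n : (Fin m → ℤ) → ℤ, (∀ a, a ∉ A → n a = 0) → ∑ a ∈ A, n a • a = 0 →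
      ∃ k : ℤ, ∃ r₁ ∈ AddSubgroup.closure (W₁ : Set ((Fin m → ℤ) → ℤ)),
        ∃ r₂ ∈ AddSubgroup.closure (W₂ : Set ((Fin m → ℤ) → ℤ)),
          n = k • w + r₁ + r₂ ∧ ∑ a ∈ A₁, n a • a = k • d := by
    intro n hn hn0
    have h1 : ∃ k : ℤ, ∃ r₁ ∈ AddSubgroup.closure (W₁ : Set ((Fin m → ℤ) → ℤ)),
        ∃ r₂ ∈ AddSubgroup.closure (W₂ : Set ((Fin m → ℤ) → ℤ)), n = k • w + r₁ + r₂ := by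
      have := hW.mem_closure n hn hn0
      clear hn hn0
      induction this using AddSubgroup.closure_induction with
      | mem x hx =>
        by_cases hxw : x = w
        · exact ⟨1, 0, zero_mem _, 0, zero_mem _, by rw [hxw]; simp⟩
        rcases hrest x hx hxw with h | h
        · exact ⟨0, x, AddSubgroup.subset_closure (Finset.mem_coe.2 (Finset.mem_filter.2
            ⟨Finset.mem_erase.2 ⟨hxw, hx⟩, h⟩)), 0, zero_mem _, by simp⟩
        · exact ⟨0, 0, zero_mem _, x, AddSubgroup.subset_closure (Finset.mem_coe.2
            (Finset.mem_filter.2 ⟨Finset.mem_erase.2 ⟨hxw, hx⟩, h⟩)), by simp⟩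
      | zero => exact ⟨0, 0, zero_mem _, 0, zero_mem _, by simp⟩
      | add x y _ _ hx hy =>
        obtain ⟨k, r₁, h₁, r₂, h₂, rfl⟩ := hx
        obtain ⟨k', r₁', h₁', r₂', h₂', rfl⟩ := hy
        exact ⟨k + k', r₁ + r₁', add_mem h₁ h₁', r₂ + r₂', add_mem h₂ h₂', by
          rw [add_smul]; abel⟩
      | neg x _ hx =>
        obtain ⟨k, r₁, h₁, r₂, h₂, rfl⟩ := hx
        exact ⟨-k, -r₁, neg_mem h₁, -r₂, neg_mem h₂, by rw [neg_smul]; abel⟩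
    obtain ⟨k, r₁, h₁, r₂, h₂, rfl⟩ := h1
    refine ⟨k, r₁, h₁, r₂, h₂, rfl, ?_⟩
    have e₁ : ∑ a ∈ A₁, r₁ a • a = 0 := by
      have := hsplit r₁
      rwa [hvan₂ r₁ (hr₁ r₁ h₁).1, add_zero, (hr₁ r₁ h₁).2] at this
    have e₂ := hvan₁ r₂ (hr₂ r₂ h₂).1
    simp_rw [Pi.add_apply, add_smul, Finset.sum_add_distrib, e₁, e₂, add_zero, Pi.smul_apply,
      smul_assoc, ← Finset.smul_sum]
    rfl
  have hk0 : ∀ k : ℤ, k • d = 0 → k = 0 := fun k hk => (smul_eq_zero.1 hk).resolve_right hd0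
  have hD₁ : IsDominatingRelations A₁ W₁ :=
    { eq_zero := fun x hx a ha => by
        by_cases haC : a ∈ C
        · exact hW.eq_zero x (hW₁W hx) a fun h => ha (Finset.mem_filter.2 ⟨h, haC⟩)
        · exact (Finset.mem_filter.1 hx).2 a haC
      sum_eq_zero := fun x hx => by
        have := hsplit x
        rwa [hvan₂ x (Finset.mem_filter.1 hx).2, add_zero, hW.sum_eq_zero x (hW₁W hx)] at this
      ne_zero := fun x hx => hW.ne_zero x (hW₁W hx)
      mem_closure := fun n hn hn0 => by
        have hnC : ∀ a, a ∉ C → n a = 0 := fun a ha => hn a fun h => ha (Finset.mem_filter.1 h).2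
        obtain ⟨k, r₁, h₁, r₂, h₂, hnr, hnk⟩ := hdec n
          (fun a ha => hn a fun h => ha (Finset.mem_filter.1 h).1)
          (by rw [← hsplit, hn0, hvan₂ n hnC, add_zero])
        rw [hk0 k (by rw [← hnk, hn0]), zero_smul, zero_add] at hnr
        have hr₂0 : r₂ = 0 := by
          funext a
          by_cases ha : a ∈ C
          · exact (hr₂ r₂ h₂).1 a ha
          · have := congrFun hnr a
            simpa [hnC a ha, (hr₁ r₁ h₁).1 a ha] using this.symm
        rwa [hnr, hr₂0, add_zero]
      card_lt := fun B hB => (Finset.card_le_card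
        (Finset.filter_subset_filter _ hW₁W)).trans_lt (hW.card_lt B hB) }
  have hD₂ : IsDominatingRelations A₂ W₂ :=
    { eq_zero := fun x hx a ha => by
        by_cases haC : a ∈ C
        · exact (Finset.mem_filter.1 hx).2 a haC
        · exact hW.eq_zero x (hW₂W hx) a fun h => ha (Finset.mem_filter.2 ⟨h, haC⟩)
      sum_eq_zero := fun x hx => by
        have := hsplit x
        rwa [hvan₁ x (Finset.mem_filter.1 hx).2, zero_add, hW.sum_eq_zero x (hW₂W hx)] at this
      ne_zero := fun x hx => hW.ne_zero x (hW₂W hx)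
      mem_closure := fun n hn hn0 => by
        have hnC : ∀ a, a ∈ C → n a = 0 := fun a ha => hn a fun h => (Finset.mem_filter.1 h).2 ha
        obtain ⟨k, r₁, h₁, r₂, h₂, hnr, hnk⟩ := hdec n
          (fun a ha => hn a fun h => ha (Finset.mem_filter.1 h).1)
          (by rw [← hsplit, hn0, hvan₁ n hnC, add_zero])
        rw [hk0 k (by rw [← hnk, hvan₁ n hnC]), zero_smul, zero_add] at hnr
        have hr₁0 : r₁ = 0 := by
          funext a
          by_cases ha : a ∈ C
          · have := congrFun hnr a
            simpa [hnC a ha, (hr₂ r₂ h₂).1 a ha] using this.symm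
          · exact (hr₁ r₁ h₁).1 a ha
        rwa [hnr, hr₁0, zero_add]
      card_lt := fun B hB => (Finset.card_le_card
        (Finset.filter_subset_filter _ hW₂W)).trans_lt (hW.card_lt B hB) }
  obtain ⟨P₁, D₁, hF₁⟩ := IH _ hlt₁ hD₁ (fun a ha => hA a (Finset.mem_filter.1 ha).1)
    (hmin.subset (Finset.filter_subset _ _)) rfl
  obtain ⟨P₂, D₂, hF₂⟩ := IH _ hlt₂ hD₂ (fun a ha => hA a (Finset.mem_filter.1 ha).1)
    (hmin.subset (Finset.filter_subset _ _)) rfl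
  have hd₁ : d ∈ AddSubmonoid.closure (A₁ : Set (Fin m → ℤ)) := sum_zsmul_mem_closure
    fun a ha => hwC a (Finset.mem_filter.1 ha).1 (Finset.mem_filter.1 ha).2
  have hd₂ : d ∈ AddSubmonoid.closure (A₂ : Set (Fin m → ℤ)) := hd' ▸ sum_zsmul_mem_closure
    fun a ha => neg_nonneg.2 (hwC' a (Finset.mem_filter.1 ha).1 (Finset.mem_filter.1 ha).2)
  refine ⟨P₁ ++ P₂, D₁ ++ d :: D₂, IsFreeGluing.glue _ _ _ d P₁ P₂ D₁ D₂
    ⟨⟨A₁, A₂, hunion.symm ▸ hmin, hdisj, ⟨p, Finset.mem_filter.2 ⟨hpA, hpC⟩⟩,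
      ⟨q, Finset.mem_filter.2 ⟨hqA, hqC⟩⟩, rfl, rfl⟩, hd₁, hd₂, le_antisymm ?_ ?_⟩ hF₁ hF₂⟩
  · rintro x ⟨hx₁, hx₂⟩
    obtain ⟨n₁, hn₁⟩ := mem_groupSpan_closure.1 hx₁
    obtain ⟨n₂, hn₂⟩ := mem_groupSpan_closure.1 hx₂
    set n : (Fin m → ℤ) → ℤ := fun a => if a ∈ A₁ then n₁ a else if a ∈ A₂ then -n₂ a else 0
    have e₁ : ∑ a ∈ A₁, n a • a = x := by
      rw [hn₁]
      exact Finset.sum_congr rfl fun a ha => by simp only [n, if_pos ha]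
    have e₂ : ∑ a ∈ A₂, n a • a = -x := by
      rw [hn₂, ← Finset.sum_neg_distrib]
      refine Finset.sum_congr rfl fun a ha => ?_
      simp only [n, if_neg (Finset.disjoint_right.1 hdisj ha), if_pos ha, neg_smul]
    obtain ⟨k, -, -, -, -, -, hk⟩ := hdec n (fun a ha => by
      have h₁ : a ∉ A₁ := fun h => ha (Finset.mem_filter.1 h).1
      have h₂ : a ∉ A₂ := fun h => ha (Finset.mem_filter.1 h).1
      simp only [n, if_neg h₁, if_neg h₂]) (by rw [← hsplit, e₁, e₂, add_neg_cancel])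
    exact AddSubgroup.mem_zmultiples_iff.2 ⟨k, by rw [← hk, e₁]⟩
  · rw [AddSubgroup.zmultiples_le]
    exact ⟨AddSubgroup.subset_closure hd₁, AddSubgroup.subset_closure hd₂⟩

end Decomposition

/-! ### Complete intersections -/

section CompleteIntersection

variable {m : ℕ} {A : Finset (Fin m → ℤ)}

/-- The difference of two exponent vectors, extended by zero to all of `ℤ^m`. -/
noncomputable def diffRel (A : Finset (Fin m → ℤ)) (p : (A → ℕ) × (A → ℕ)) : (Fin m → ℤ) → ℤ :=
  open scoped Classical in fun a => if h : a ∈ A then (p.1 ⟨a, h⟩ : ℤ) - p.2 ⟨a, h⟩ else 0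

theorem diffRel_of_notMem (p : (A → ℕ) × (A → ℕ)) {a : Fin m → ℤ} (ha : a ∉ A) :
    diffRel A p a = 0 := dif_neg ha

theorem diffRel_coe (p : (A → ℕ) × (A → ℕ)) (a : A) :
    diffRel A p a = (p.1 a : ℤ) - p.2 a := dif_pos a.2

theorem sum_diffRel (p : (A → ℕ) × (A → ℕ)) :
    ∑ a ∈ A, diffRel A p a • a = genHom A p.1 - genHom A p.2 := by
  rw [← Finset.sum_coe_sort A]
  change _ = ∑ a : A, p.1 a • (a : Fin m → ℤ) - ∑ a : A, p.2 a • (a : Fin m → ℤ)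
  rw [← Finset.sum_sub_distrib]
  exact Finset.sum_congr rfl fun a _ => by
    rw [diffRel_coe, sub_smul, natCast_zsmul, natCast_zsmul]

/-- The differences of the relations of a presentation generate the lattice of all relations. -/
theorem IsPresentation.diffRel_mem_closure {ρ : Finset ((A → ℕ) × (A → ℕ))}
    (hρ : IsPresentation A ρ) {u v : A → ℕ} (huv : genHom A u = genHom A v) :
    diffRel A (u, v) ∈ AddSubgroup.closure (diffRel A '' ρ) := by
  have hadd : ∀ u v w z : A → ℕ, diffRel A (u + w, v + z) = diffRel A (u, v) + diffRel A (w, z) := by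
    intro u v w z
    funext a
    by_cases ha : a ∈ A
    · have h := fun p => diffRel_coe (A := A) p ⟨a, ha⟩
      simp only [h, Pi.add_apply]
      push_cast
      ring
    · simp [diffRel_of_notMem _ ha]
  have hcancel : ∀ u v w : A → ℕ, diffRel A (u, w) = diffRel A (u, v) + diffRel A (v, w) := by
    intro u v w
    funext a
    by_cases ha : a ∈ A
    · have h := fun p => diffRel_coe (A := A) p ⟨a, ha⟩
      simp only [h, Pi.add_apply]
      ring
    · simp [diffRel_of_notMem _ ha]
  have hself : ∀ u : A → ℕ, diffRel A (u, u) = 0 := fun u => by simpa using hcancel u u u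
  let c : AddCon (A → ℕ) :=
    { r := fun u v => diffRel A (u, v) ∈ AddSubgroup.closure (diffRel A '' ρ)
      iseqv :=
        { refl := fun u => by rw [hself]; exact zero_mem _
          symm := fun {u v} h => by
            have := hcancel u v u
            rw [hself] at this
            rw [eq_neg_of_add_eq_zero_right this.symm]
            exact neg_mem h
          trans := fun {u v w} h h' => by
            rw [hcancel u v w]
            exact add_mem h h' }
      add' := fun {u v w z} h h' => by
        rw [hadd]
        exact add_mem h h' }
  have hle : addConGen (fun x y => (x, y) ∈ ρ) ≤ c :=
    AddCon.addConGen_le.2 fun u v h => AddSubgroup.subset_closure ⟨(u, v), h, rfl⟩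
  rw [hρ] at hle
  exact hle ((AddCon.ker_rel _).2 huv)

/-- The rational relations between the vectors in `A`. -/
noncomputable def ratRelations (A : Finset (Fin m → ℤ)) : Submodule ℚ (A → ℚ) :=
  LinearMap.ker (Fintype.linearCombination ℚ fun a : A => toRat (a : Fin m → ℤ))

theorem finrank_ratRelations_add_spanDim :
    Module.finrank ℚ (ratRelations A) +
      spanDim (AddSubmonoid.closure (A : Set (Fin m → ℤ))) = A.card := by
  have hspan : Submodule.span ℚ (toRat '' (AddSubmonoid.closure (A : Set (Fin m → ℤ)) :
      Set (Fin m → ℤ))) =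
      LinearMap.range (Fintype.linearCombination ℚ fun a : A => toRat (a : Fin m → ℤ)) := by
    rw [Fintype.range_linearCombination]
    refine le_antisymm (Submodule.span_le.2 ?_) (Submodule.span_mono ?_)
    · rintro _ ⟨s, hs, rfl⟩
      induction hs using AddSubmonoid.closure_induction with
      | mem x hx => exact Submodule.subset_span ⟨⟨x, hx⟩, rfl⟩
      | zero =>
        have : toRat (0 : Fin m → ℤ) = 0 := by ext i; simp [toRat]
        rw [this]
        exact zero_mem _
      | add x y _ _ hx hy =>
        rw [toRat_add]
        exact add_mem hx hy
    · rintro _ ⟨a, rfl⟩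
      exact ⟨a, AddSubmonoid.subset_closure a.2, rfl⟩
  rw [spanDim, hspan, ratRelations, add_comm, LinearMap.finrank_range_add_finrank_ker,
    Module.finrank_fintype_fun_eq_card, Fintype.card_coe]

theorem genHom_eq_of_ratVec_sub_mem {u v : A → ℕ} (h : ratVec u - ratVec v ∈ ratRelations A) :
    genHom A u = genHom A v := by
  have hg : ∀ w : A → ℕ, toRat (genHom A w) =
      Fintype.linearCombination ℚ (fun a : A => toRat (a : Fin m → ℤ)) (ratVec w) := by
    intro w
    change toRat (∑ a : A, w a • (a : Fin m → ℤ)) = _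
    rw [toRat_sum, Fintype.linearCombination_apply]
    refine Finset.sum_congr rfl fun a _ => ?_
    rw [← natCast_zsmul, toRat_zsmul, ratVec, Int.cast_natCast]
  apply toRat_injective
  rw [hg, hg, ← sub_eq_zero, ← map_sub]
  exact h

theorem genHom_eq_zero_iff (hA : ∀ a ∈ A, 0 ≤ a) (hA0 : (0 : Fin m → ℤ) ∉ A) (u : A → ℕ) :
    genHom A u = 0 ↔ u = 0 := by
  refine ⟨fun h => funext fun a => ?_, fun h => by rw [h, map_zero]⟩
  have h1 := eq_zero_of_sum_zsmul_eq_zero hA hA0 (n := diffRel A (u, 0))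
    (fun a ha => by rw [diffRel_coe (u, 0) ⟨a, ha⟩]; simp)
    (by rw [sum_diffRel, h, map_zero, sub_zero]) a a.2
  simpa [diffRel_coe] using h1

open scoped Classical in
/-- The differences of the relations of a presentation whose size is the rank of the lattice of
relations form a dominating system. -/
theorem IsPresentation.isDominatingRelations (hA : ∀ a ∈ A, 0 ≤ a) (hA0 : (0 : Fin m → ℤ) ∉ A)
    {ρ : Finset ((A → ℕ) × (A → ℕ))} (hρ : IsPresentation A ρ)
    (hcard : ρ.card + spanDim (AddSubmonoid.closure (A : Set (Fin m → ℤ))) = A.card) :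
    IsDominatingRelations A ((ρ.image (diffRel A)).erase 0) := by
  have hker : ∀ p ∈ ρ, genHom A p.1 = genHom A p.2 := by
    intro p hp
    have : addConGen (fun x y => (x, y) ∈ ρ) p.1 p.2 := AddConGen.Rel.of _ _ hp
    rw [hρ] at this
    exact (AddCon.ker_rel _).1 this
  have hfin : Module.finrank ℚ (ratRelations A) = ρ.card := by
    have := finrank_ratRelations_add_spanDim (A := A)
    omega
  have hdom := card_filter_lt_card (ratRelations A) ρ hfin
    (fun u v huv => by
      have h : AddCon.ker (genHom A) u v := (AddCon.ker_rel _).2 (genHom_eq_of_ratVec_sub_mem huv)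
      rwa [← hρ] at h)
    (fun p hp => by
      rw [← genHom_eq_zero_iff hA hA0, ← genHom_eq_zero_iff hA hA0, hker p hp])
  have hmem : ∀ w ∈ (ρ.image (diffRel A)).erase 0, ∃ p ∈ ρ, diffRel A p = w := fun w hw =>
    Finset.mem_image.1 (Finset.mem_of_mem_erase hw)
  refine ⟨?_, ?_, fun w hw => Finset.ne_of_mem_erase hw, ?_, ?_⟩
  · intro w hw a ha
    obtain ⟨p, -, rfl⟩ := hmem w hw
    exact diffRel_of_notMem p ha
  · intro w hw
    obtain ⟨p, hp, rfl⟩ := hmem w hw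
    rw [sum_diffRel, hker p hp, sub_self]
  · intro n hn hn0
    -- Write the relation as a difference of two exponent vectors with equal images.
    obtain ⟨u, v, hnd⟩ : ∃ u v : A → ℕ, diffRel A (u, v) = n := by
      refine ⟨fun a => (n a).toNat, fun a => (-n a).toNat, funext fun a => ?_⟩
      by_cases ha : a ∈ A
      · rw [diffRel_coe _ ⟨a, ha⟩]
        exact Int.toNat_sub_toNat_neg (n a)
      · rw [diffRel_of_notMem _ ha, hn a ha]
    have hsum := sum_diffRel (u, v)
    rw [hnd, hn0] at hsum
    have h1 := hρ.diffRel_mem_closure (sub_eq_zero.1 hsum.symm)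
    rw [hnd] at h1
    refine (AddSubgroup.closure_le _).2 ?_ h1
    rintro _ ⟨p, hp, rfl⟩
    by_cases h0 : diffRel A p = 0
    · rw [h0]
      exact zero_mem _
    · exact AddSubgroup.subset_closure (Finset.mem_coe.2
        (Finset.mem_erase.2 ⟨h0, Finset.mem_image_of_mem _ hp⟩))
  · intro C hC
    have hsub : ((ρ.image (diffRel A)).erase 0).filter
        (fun w => (∃ a ∈ C, 0 < w a) ∧ ∃ a ∈ C, w a < 0) ⊆
        (ρ.filter fun p => (∃ a ∈ C.subtype (· ∈ A), p.1 a ≠ 0) ∧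
          ∃ a ∈ C.subtype (· ∈ A), p.2 a ≠ 0).image (diffRel A) := by
      intro w hw
      obtain ⟨hw, ⟨a, haC, ha⟩, b, hbC, hb⟩ := Finset.mem_filter.1 hw
      obtain ⟨p, hp, rfl⟩ := hmem w hw
      have haA : a ∈ A := by
        by_contra h
        simp [diffRel_of_notMem p h] at ha
      have hbA : b ∈ A := by
        by_contra h
        simp [diffRel_of_notMem p h] at hb
      rw [diffRel_coe p ⟨a, haA⟩] at ha
      rw [diffRel_coe p ⟨b, hbA⟩] at hb
      exact Finset.mem_image_of_mem _ (Finset.mem_filter.2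
        ⟨hp, ⟨⟨a, haA⟩, Finset.mem_subtype.2 haC, by omega⟩,
          ⟨b, hbA⟩, Finset.mem_subtype.2 hbC, by omega⟩)
    have hle := (Finset.card_le_card hsub).trans Finset.card_image_le
    have hsubcard : (C.subtype (· ∈ A)).card ≤ C.card := by
      rw [Finset.card_subtype]
      exact Finset.card_filter_le _ _
    rcases (C.subtype (· ∈ A)).eq_empty_or_nonempty with hempty | hne
    · simp only [hempty, Finset.notMem_empty, false_and, exists_false, Finset.filter_false,
        Finset.card_empty] at hle
      exact hle.trans_lt hC.card_pos
    · exact hle.trans_lt ((hdom _ hne).trans_le hsubcard)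

/-- A complete intersection affine semigroup is obtained from free semigroups by gluings. -/
theorem IsCompleteIntersection.exists_isFreeGluing {S : AddSubmonoid (Fin m → ℤ)}
    (hS : ∀ s ∈ S, 0 ≤ s) (hci : IsCompleteIntersection S) : ∃ P D, IsFreeGluing S P D := by
  obtain ⟨A, hA, ρ, hρ, hcard⟩ := hci
  obtain rfl := hA.1
  have hnn : ∀ a ∈ A, 0 ≤ a := fun a ha => hS a (hA.mem ha)
  exact (hρ.1.isDominatingRelations hnn hA.zero_notMem hcard).exists_isFreeGluing hnn hA

end CompleteIntersection

end AffineSemigroup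

theorem mainTheorem5 (m : ℕ) (S : AddSubmonoid (Fin m → ℤ))
    (hS : AffineSemigroup.IsAffineSemigroup S) (hS0 : S ≠ ⊥)
    (hci : AffineSemigroup.IsCompleteIntersection S) :
    (∃ f : Fin m → ℤ, AffineSemigroup.IsFrobeniusVector S f) ∧
    (∃ (P : List (Finset (Fin m → ℤ))) (D : List (Fin m → ℤ)),
      AffineSemigroup.IsFreeGluing S P D) ∧
    (∀ (A : Finset (Fin m → ℤ)) (P : List (Finset (Fin m → ℤ))) (D : List (Fin m → ℤ)),
      AffineSemigroup.IsMinGen A S → AffineSemigroup.IsFreeGluing S P D →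
      AffineSemigroup.IsFrobeniusVector S (D.sum - ∑ a ∈ A, a)) := by
  have hne : ∀ A : Finset (Fin m → ℤ), AffineSemigroup.IsMinGen A S → A.Nonempty := by
    intro A hA
    rw [Finset.nonempty_iff_ne_empty]
    rintro rfl
    exact hS0 (by rw [← hA.1]; simp)
  have hfrob := fun (A : Finset (Fin m → ℤ)) (P : List (Finset (Fin m → ℤ)))
    (D : List (Fin m → ℤ)) (hA : AffineSemigroup.IsMinGen A S)
    (h : AffineSemigroup.IsFreeGluing S P D) => h.isFrobeniusVector hS.2 hA (hne A hA)
  obtain ⟨P, D, hPD⟩ := hci.exists_isFreeGluing hS.2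
  obtain ⟨A, hA, -⟩ := hci
  exact ⟨⟨_, hfrob A P D hA hPD⟩, ⟨P, D, hPD⟩, hfrob⟩
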